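/- Let $X$ be a Poisson process with intensity $\lambda>0$ and let $b>0$. For a regulation type (I, II or III) and a degree $n\ge 0$, let $Y$ be the regulated clock of that type and degree built from the scaled process $Z=X/b$. That is, $Y$ is a Lévy subordinator with the following one-dimensional laws. If $n$ is an integer, $Y_t$ has the law of the $n$-fold running average $\frac1t\int_0^t(\cdot)_s\,ds$ of $Z$ (type I). For type II, $Y=Y^{(n)}$, where $Y^{(0)}=Z$ and $Y^{(j)}$ is a Lévy subordinator for which $Y^{(j)}_t$ has the law of $\frac1t\int_0^tY^{(j-1)}_s\,ds$. For type III, $Y_t$ has the law of $t^{-n}$ times the $n$-fold iterated integral of $Z$ over $[0,t]$. For $n=0$ there is no regulation. For real $n>0$, with $\psi(u)=\log \mathsf{E}e^{-uZ_1}$, the laws are given by $\mathsf{E}e^{-uY_t}=e^{t\psi_n(u)}$, $u\ge0$, where \[ \psi_n(u)=\int_0^1\psi\Big(\big(1-\tfrac{\Gamma(n,-\log s)}{\Gamma(n)}\big)u\Big)ds,\quad \frac1{\Gamma(n)}\int_0^1(-\log v)^{n-1}\psi(uv)\,dv,\quad \int_0^1\psi\Big(\tfrac{s^nu}{\Gamma(n+1)}\Big)ds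 \] for types I, II, III respectively. Correspondingly, for $m\ge1$, let $\rho(m,n)$ be \[ \int_0^1\Big(1-\tfrac{\Gamma(n,-\log s)}{\Gamma(n)}\Big)^m ds\ \ (=1\text{ if }n=0),\qquad \frac1{(m+1)^n},\qquad \frac1{(mn+1)\Gamma(n+1)^m}. \] Consider the jump--diffusion $L_t=\mu t+\kappa_1Y_t-\kappa_2Y'_t+\sigma W_t$ with $\kappa_1=0$, $\kappa_2=1$ (downside jumps), where $Y'$ is a copy of $Y$, $W$ is a standard Brownian motion, $Y,Y',W$ are independent, and the parameters are $\lambda,b,\sigma>0$, $\mu\in\mathbb{R}$. Let $K(m)$ be the $m$-th cumulant of $L_\Delta$ for a fixed $\Delta>0$, and let $[M]$, $[V]>0$, $[SK]$, $[EK]$ be real numbers (the sample mean, variance, skewness and excess kurtosis). The moment conditions are \[ K(1)=[M],\quad K(2)=[V],\quad K(3)=[SK][V]^{3/2},\quad \frac{K(3)}{K(4)}=\frac{[SK]}{[EK][V]^{1/2}} . \] (a) Parameters $(\lambda,b,\mu,\sigma)$ satisfy the moment conditions (the Laplace transform of $L_\Delta$ then being finite near $0$) if and only if $[SK]<0$,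 $[EK]>0$ and \[ b=\frac{|[SK]|}{[EK][V]^{1/2}}\frac{\rho(4,n)}{\rho(3,n)},\quad \lambda=\frac{|[SK]|[V]^{3/2}b^3}{\Delta\,\rho(3,n)},\quad \sigma^2=\frac{[V]}{\Delta}-\rho(2,n)\frac{\lambda}{b^2},\quad \mu=\frac{[M]}{\Delta}+\rho(1,n)\frac{\lambda}{b}. \] (b) The moment conditions have exactly one solution with $\lambda,b,\sigma>0$ if and only if $[SK]<0$, $[EK]>0$ and $\rho(2,n)\rho(4,n)[SK]^2<\rho(3,n)^2[EK]$. -/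

import Mathlib

open MeasureTheory ProbabilityTheory Set
open scoped NNReal

noncomputable section

namespace ClockRegulation

/-- The three recipes for regulating a stochastic clock. -/
inductive RegType : Type
  | I
  | II
  | III

/-- The upper incomplete gamma function `Γ(a, x) = ∫_x^∞ t^(a-1) e^(-t) dt`. -/
def upperGamma (a x : ℝ) : ℝ := ∫ t in Ioi x, t ^ (a - 1) * Real.exp (-t)

/-- The coefficient `C_{m,n} = ∫_0^1 (1 - Γ(n, -log s)/Γ(n))^m ds` for `n > 0`; for `n = 0`
(no regulation) it is `1`, which is the limit as `n ↓ 0`. -/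
def C (m : ℕ) (n : ℝ) : ℝ :=
  if n = 0 then 1
  else ∫ s in (0 : ℝ)..1, (1 - upperGamma n (-Real.log s) / Real.Gamma n) ^ m

/-- The type-specific factors `ρ(m, n)`, for `m ≥ 1` and real `n ≥ 0`. -/
def rho : RegType → ℕ → ℝ → ℝ
  | .I, m, n => C m n
  | .II, m, n => 1 / ((m : ℝ) + 1) ^ n
  | .III, m, n => 1 / (((m : ℝ) * n + 1) * Real.Gamma (n + 1) ^ m)

section Processes

variable {Ω : Type*} [MeasurableSpace Ω]

/-- A Lévy subordinator: it starts at `0`, has independent and stationary increments, and its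
paths are almost surely nondecreasing and right-continuous. -/
structure IsSubordinator (X : ℝ≥0 → Ω → ℝ) (P : Measure Ω) : Prop where
  aemeasurable : ∀ t, AEMeasurable (X t) P
  zero : ∀ᵐ ω ∂P, X 0 ω = 0
  indep : HasIndepIncrements X P
  stationary : ∀ s t, IdentDistrib (fun ω => X (s + t) ω - X s ω) (X t) P P
  mono : ∀ᵐ ω ∂P, Monotone fun t => X t ω
  rightCont : ∀ᵐ ω ∂P, ∀ t, ContinuousWithinAt (fun s => X s ω) (Ici t) t

/-- A Poisson process with intensity `lam`. -/
structure IsPoissonProcess (lam : ℝ) (X : ℝ≥0 → Ω → ℝ) (P : Measure Ω) : Prop where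
  subordinator : IsSubordinator X P
  law : ∀ t, P.map (X t) = (poissonMeasure (lam.toNNReal * t)).map (fun k : ℕ => (k : ℝ))

/-- Cumulation of paths, `t ↦ ∫_0^t X_s ds`. -/
def pathIntegral (X : ℝ≥0 → Ω → ℝ) (t : ℝ≥0) (ω : Ω) : ℝ :=
  ∫ s in (0 : ℝ)..t, X s.toNNReal ω

/-- Running average of paths, `t ↦ (1/t) ∫_0^t X_s ds`, with value `0` at `t = 0`
(since `0⁻¹ = 0`). -/
def runningAverage (X : ℝ≥0 → Ω → ℝ) (t : ℝ≥0) (ω : Ω) : ℝ :=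
  (t : ℝ)⁻¹ * pathIntegral X t ω

/-- The (real) log-Laplace transform `log E e^(-uZ)`. -/
def logLaplace (P : Measure Ω) (Z : Ω → ℝ) (u : ℝ) : ℝ :=
  Real.log (∫ ω, Real.exp (-u * Z ω) ∂P)

/-- The one-dimensional laws of `Y` are those produced from the clock `X` by the averaging recipe
of the given type and of integer degree `k`:
* type I: `Y_t` has the law of the `k`-fold running average of `X`;
* type II: there are Lévy subordinators `Z 0 = X, Z 1, …, Z k`, each induced by the running average
  of the preceding one, and `Y_t` has the law of `Z k` at `t`;
* type III: `Y_t` has the law of `t^(-k)` times the `k`-fold path integral of `X`. -/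
def RegulatedByAveraging (P : Measure Ω) (X Y : ℝ≥0 → Ω → ℝ) (k : ℕ) : RegType → Prop
  | .I => ∀ t, IdentDistrib (Y t) (runningAverage^[k] X t) P P
  | .II => ∃ Z : ℕ → ℝ≥0 → Ω → ℝ, Z 0 = X ∧
      (∀ j < k, IsSubordinator (Z (j + 1)) P ∧
        ∀ t, IdentDistrib (Z (j + 1) t) (runningAverage (Z j) t) P P) ∧
      ∀ t, IdentDistrib (Y t) (Z k t) P P
  | .III => ∀ t, IdentDistrib (Y t) (fun ω => ((t : ℝ) ^ k)⁻¹ * (pathIntegral^[k] X) t ω) P P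

/-- The log-Laplace transform at time `1` of the regulated clock of real degree `n > 0`. -/
def regulatedLogLaplace (P : Measure Ω) (X : ℝ≥0 → Ω → ℝ) (n : ℝ) : RegType → ℝ → ℝ
  | .I, u => ∫ s in (0 : ℝ)..1,
      logLaplace P (X 1) ((1 - upperGamma n (-Real.log s) / Real.Gamma n) * u)
  | .II, u => 1 / Real.Gamma n *
      ∫ v in (0 : ℝ)..1, (-Real.log v) ^ (n - 1) * logLaplace P (X 1) (u * v)
  | .III, u => ∫ s in (0 : ℝ)..1, logLaplace P (X 1) (s ^ n * u / Real.Gamma (n + 1))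

/-- `Y` is a regulated `X`-clock of the given type and of degree `n ≥ 0`: a Lévy subordinator whose
one-dimensional laws are produced by the averaging recipe (if `n` is an integer, `n = 0` being the
unregulated case), or, as the extension to real degrees, are given by the Laplace transforms for
real `n > 0`. For positive integers either description is accepted. -/
def IsRegulatedClock (P : Measure Ω) (ty : RegType) (n : ℝ) (X Y : ℝ≥0 → Ω → ℝ) : Prop :=
  IsSubordinator Y P ∧
    ((∃ k : ℕ, n = k ∧ RegulatedByAveraging P X Y k ty) ∨
      (0 < n ∧ ∀ (t : ℝ≥0) (u : ℝ), 0 ≤ u →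
        ∫ ω, Real.exp (-u * Y t ω) ∂P = Real.exp (t * regulatedLogLaplace P X n ty u)))

end Processes

/-- The parameters of the jump-diffusion model: Poisson intensity `lam`, rate (reciprocal jump
scale) `b`, location `mu` and Brownian dispersion `sigma`. -/
@[ext] structure Params : Type where
  lam : ℝ
  b : ℝ
  mu : ℝ
  sigma : ℝ

/-- The parameter domain: `lam, b, sigma > 0`, and `mu` real. -/
def Params.Admissible (p : Params) : Prop := 0 < p.lam ∧ 0 < p.b ∧ 0 < p.sigma

section Model

variable {Ω : Type*} [MeasurableSpace Ω]

/-- `L` is the Poisson-based jump-diffusion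
`L_t = mu t + κ₁ Y_t - κ₂ Y'_t + sigma W_t`, where `Y` is the regulated clock of degree `n` of the
scaled Poisson process `X / b`, `Y'` is a copy of `Y`, `W` is a standard Brownian motion, and
`Y`, `Y'`, `W` are independent. -/
def IsJumpDiffusion (P : Measure Ω) (ty : RegType) (n κ₁ κ₂ : ℝ) (p : Params)
    (L : ℝ≥0 → Ω → ℝ) : Prop :=
  ∃ X Y Y' W : ℝ≥0 → Ω → ℝ,
    IsPoissonProcess p.lam X P ∧
    IsRegulatedClock P ty n (fun t ω => X t ω / p.b) Y ∧
    IdentDistrib (fun ω t => Y' t ω) (fun ω t => Y t ω) P P ∧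
    IsBrownianReal W P ∧
    iIndepFun (fun (i : Fin 3) (ω : Ω) (t : ℝ≥0) => (![Y, Y', W] i) t ω) P ∧
    ∀ t, ∀ᵐ ω ∂P, L t ω = p.mu * t + κ₁ * Y t ω - κ₂ * Y' t ω + p.sigma * W t ω

/-- The `m`-th cumulant: `m!` times the coefficient of `u^m` in `log E e^(uZ)`, i.e. of `(-u)^m`
in the log-Laplace transform. -/
def cumulant (P : Measure Ω) (Z : Ω → ℝ) (m : ℕ) : ℝ := iteratedDeriv m (cgf Z P) 0

/-- The four moment conditions that match the cumulants of the model variable `Z` with the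
sample mean `M`, variance `V`, skewness `SK` and excess kurtosis `EK`. The first clause says that
the Laplace transform of `Z` is finite near `0`, so that the cumulants exist. -/
structure MatchesSample (P : Measure Ω) (Z : Ω → ℝ) (M V SK EK : ℝ) : Prop where
  expMoments : 0 ∈ interior (integrableExpSet Z P)
  first : cumulant P Z 1 = M
  second : cumulant P Z 2 = V
  third : cumulant P Z 3 = SK * V ^ (3 / 2 : ℝ)
  ratio : cumulant P Z 3 / cumulant P Z 4 = SK / (EK * V ^ (1 / 2 : ℝ))

end Model

end ClockRegulation

end

/-! With downside jumps, `L_Δ` is a drift minus a compound Poisson variable plus an independent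
normal one, so the matter reduces to the law of the regulated clock at one time. For every type and
degree, and `t > 0`, the Laplace exponent of `Y_t` is `t λ ∫ (e^(-ux) - 1) ν(dx)`, where `ν` is a
probability law on a bounded interval `[0, G]` with moments `ρ(m, n) / b^m`
(`IsRegulatedClock.hasCompoundPoissonLaplace`). For integer degrees of types I and III, the recipe
is linear in the path: approximating the path by steps gives a sum of independent increments,
weighted by the effect of the recipe on unit steps, and the exponents form convergent Riemann sums
(`IsSubordinator.integral_exp_iterate`). For type II, one running average multiplies each jump by an
independent uniform variable, and induction applies. For real degrees the exponent is given, and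
only `ν` has to be identified.

These identities are known for `u ≥ 0` only, whereas cumulants need a neighbourhood of `0`. Bounded
jumps make the right-hand side entire, and for a nonnegative variable this forces all exponential
moments to exist (`integrable_exp_mul_of_entire`).

Hence `K(m) = (-1)^m Δ λ ρ(m, n) / b^m`, plus `μ Δ` for `m = 1` and `σ² Δ` for `m = 2`. The ratio
`K(3)/K(4)` is free of `λ` and fixes `b`; then `K(3)` fixes `λ`, `K(2)` fixes `σ²` and `K(1)` fixes
`μ`. The signs `K(3) < 0 < K(4)` force `SK < 0 < EK`. The only remaining obstruction is `σ² > 0`,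
which is the inequality in (b). -/

namespace ClockRegulation

/-! ### Exponential moments by analytic continuation -/

open Filter Topology in
/-- Two functions that agree on the negative reals and are holomorphic on the left half plane agree
there. -/
theorem eqOn_left_half_plane {F H : ℂ → ℂ} (hF : AnalyticOnNhd ℂ F {z | z.re < 0})
    (hH : AnalyticOnNhd ℂ H {z | z.re < 0}) (h : ∀ x : ℝ, x < 0 → F x = H x) :
    EqOn F H {z | z.re < 0} := by
  have hconv : Convex ℝ {z : ℂ | z.re < 0} := convex_halfSpace_re_lt 0
  refine hF.eqOn_of_preconnected_of_frequently_eq hH hconv.isPreconnected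
    (z₀ := ((-1 : ℝ) : ℂ)) (by simp) ?_
  have h_real : ∃ᶠ x : ℝ in 𝓝[≠] (-1), F x = H x := by
    have h1 : ∀ᶠ x : ℝ in 𝓝[≠] (-1), x < 0 :=
      eventually_nhdsWithin_of_eventually_nhds (eventually_lt_nhds (by norm_num))
    exact (h1.mono fun x hx => h x hx).frequently
  rw [frequently_iff_seq_forall] at h_real ⊢
  obtain ⟨xs, hx_tendsto, hx_eq⟩ := h_real
  refine ⟨fun n ↦ xs n, ?_, hx_eq⟩
  rw [tendsto_nhdsWithin_iff] at hx_tendsto ⊢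
  exact ⟨(Complex.continuous_ofReal.tendsto (-1)).comp hx_tendsto.1,
    hx_tendsto.2.mono fun n hn h => hn (Complex.ofReal_injective h)⟩

section Laplace

variable {Ω : Type*} [MeasurableSpace Ω]

theorem integrable_exp_mul_of_nonpos {P : Measure Ω} [IsFiniteMeasure P] {Y : Ω → ℝ}
    (hY : AEMeasurable Y P) (hY0 : ∀ᵐ ω ∂P, 0 ≤ Y ω) {u : ℝ} (hu : u ≤ 0) :
    Integrable (fun ω => Real.exp (u * Y ω)) P := by
  refine .of_mem_Icc 0 1 (Real.measurable_exp.comp_aemeasurable (hY.const_mul u)) ?_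
  filter_upwards [hY0] with ω h
  exact ⟨(Real.exp_pos _).le, Real.exp_le_one_iff.2 (mul_nonpos_of_nonpos_of_nonneg hu h)⟩

open Nat in
/-- If the Laplace transform of a nonnegative random variable extends to an entire function, then
all its exponential moments are finite and are given by this function. -/
theorem integrable_exp_mul_of_entire {P : Measure Ω} [IsFiniteMeasure P] {Y : Ω → ℝ}
    (hY : AEMeasurable Y P) (hY0 : ∀ᵐ ω ∂P, 0 ≤ Y ω) {H : ℂ → ℂ} (hH : Differentiable ℂ H)
    (h : ∀ u : ℝ, u ≤ 0 → (mgf Y P u : ℂ) = H u) (u : ℝ) :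
    Integrable (fun ω => Real.exp (u * Y ω)) P ∧ (mgf Y P u : ℂ) = H u := by
  rcases le_or_gt u 0 with hu | hu
  · exact ⟨integrable_exp_mul_of_nonpos hY hY0 hu, h u hu⟩
  have hsub : Iio (0 : ℝ) ⊆ interior (integrableExpSet Y P) := by
    rw [isOpen_Iio.subset_interior_iff]
    exact fun v hv => integrable_exp_mul_of_nonpos hY hY0 (le_of_lt hv)
  have hm1 : ((-1 : ℂ)).re ∈ interior (integrableExpSet Y P) := hsub (by simp)
  have hm1' : (-1 : ℝ) ∈ interior (integrableExpSet Y P) := hsub (by simp)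
  have heq : EqOn (complexMGF Y P) H {z | z.re < 0} := by
    refine eqOn_left_half_plane (analyticOnNhd_complexMGF.mono fun z hz => hsub hz)
      (fun z _ => hH.analyticAt z) fun x hx => ?_
    rw [complexMGF_ofReal, h x hx.le]
  have hev : complexMGF Y P =ᶠ[nhds (-1)] H :=
    heq.eventuallyEq_of_mem ((isOpen_lt Complex.continuous_re continuous_const).mem_nhds (by simp))
  -- Expansion about `-1`, a point where the transform is already known to be analytic: `e^(uY) =
  -- e^(-Y) ∑ (u+1)^k Y^k / k!`. All terms are nonnegative because `u > 0`, so convergence of the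
  -- series of integrals, a Taylor series of `H`, gives integrability by Tonelli.
  set F : ℕ → Ω → ℝ := fun k ω => (k ! : ℝ)⁻¹ * (u + 1) ^ k * (Y ω ^ k * Real.exp (-1 * Y ω))
    with hFdef
  have hFint : ∀ k, Integrable (F k) P := fun k =>
    (integrable_pow_mul_exp_of_mem_interior_integrableExpSet hm1' k).const_mul _
  have hcoef : ∀ k, iteratedDeriv k H (-1) = ((∫ ω, Y ω ^ k * Real.exp (-1 * Y ω) ∂P : ℝ) : ℂ) := by
    intro k
    rw [← hev.iteratedDeriv_eq k, iteratedDeriv_complexMGF hm1, ← integral_complex_ofReal]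
    congr 1 with ω
    push_cast
    ring
  have hsum : HasSum (fun k => ((∫ ω, F k ω ∂P : ℝ) : ℂ)) (H u) := by
    convert! Complex.hasSum_taylorSeries_of_entire hH (-1) u using 2 with k
    rw [hcoef, hFdef, integral_const_mul]
    simp only [smul_eq_mul]
    push_cast
    ring
  have hsumR : Summable fun k => ∫ ω, F k ω ∂P := by
    have := (Complex.reCLM.hasSum hsum).summable
    simpa [Function.comp_def] using this
  have hpt : ∀ ω, HasSum (fun k => F k ω) (Real.exp (u * Y ω)) := by
    intro ω
    have := (NormedSpace.expSeries_div_hasSum_exp ((u + 1) * Y ω)).mul_right (Real.exp (-1 * Y ω))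
    rw [← Real.exp_eq_exp_ℝ, ← Real.exp_add] at this
    convert! this using 2 with k
    · simp only [hFdef, mul_pow]; ring
    · ring
  have hF0 : ∀ᵐ ω ∂P, ∀ k, 0 ≤ F k ω := by
    filter_upwards [hY0] with ω h k
    simp only [hFdef]
    positivity
  have hnorm : Summable fun k => ∫ ω, ‖F k ω‖ ∂P := by
    convert! hsumR using 2 with k
    refine integral_congr_ae ?_
    filter_upwards [hF0] with ω h
    exact Real.norm_of_nonneg (h k)
  have hS := hasSum_integral_of_summable_integral_norm hFint hnorm
  simp only [(hpt _).tsum_eq] at hS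
  refine ⟨?_, ?_⟩
  · refine ⟨(Real.measurable_exp.comp_aemeasurable (hY.const_mul u)).aestronglyMeasurable, ?_⟩
    have h1 : ∫⁻ ω, ‖Real.exp (u * Y ω)‖ₑ ∂P = ∑' k, ∫⁻ ω, ‖F k ω‖ₑ ∂P := by
      rw [← lintegral_tsum fun k => (hFint k).aestronglyMeasurable.enorm]
      refine lintegral_congr_ae ?_
      filter_upwards [hF0] with ω h
      rw [Real.enorm_of_nonneg (Real.exp_pos _).le, ← (hpt ω).tsum_eq,
        ENNReal.ofReal_tsum_of_nonneg h (hpt ω).summable]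
      simp only [Real.enorm_of_nonneg (h _)]
    rw [HasFiniteIntegral, h1]
    have h2 : ∀ k, ∫⁻ ω, ‖F k ω‖ₑ ∂P = ENNReal.ofReal (∫ ω, ‖F k ω‖ ∂P) := fun k =>
      (ofReal_integral_norm_eq_lintegral_enorm (hFint k)).symm
    simp_rw [h2]
    rw [← ENNReal.ofReal_tsum_of_nonneg (fun k => integral_nonneg fun ω => norm_nonneg _) hnorm]
    exact ENNReal.ofReal_lt_top
  · have := Complex.ofRealCLM.hasSum hS
    exact this.unique hsum

theorem integrable_exp_mul_id {ν : Measure ℝ} [IsFiniteMeasure ν] {G : ℝ}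
    (hν : ∀ᵐ x ∂ν, x ∈ Icc 0 G) (u : ℝ) : Integrable (fun x => Real.exp (u * id x)) ν :=
  integrable_exp_mul_of_mem_Icc aemeasurable_id hν

theorem integrableExpSet_id_eq_univ {ν : Measure ℝ} [IsFiniteMeasure ν] {G : ℝ}
    (hν : ∀ᵐ x ∂ν, x ∈ Icc 0 G) : integrableExpSet id ν = univ :=
  eq_univ_of_forall fun u => integrable_exp_mul_id hν u

/-- A nonnegative random variable with the Laplace transform of a compound Poisson law with bounded
jumps has the moment-generating function of this law. -/
theorem mgf_eq_of_laplace_eq {P : Measure Ω} [IsFiniteMeasure P] {Y : Ω → ℝ}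
    (hY : AEMeasurable Y P) (hY0 : ∀ᵐ ω ∂P, 0 ≤ Y ω) {ν : Measure ℝ} [IsFiniteMeasure ν] {G c : ℝ}
    (hν : ∀ᵐ x ∂ν, x ∈ Icc 0 G)
    (h : ∀ u : ℝ, 0 ≤ u →
      ∫ ω, Real.exp (-u * Y ω) ∂P = Real.exp (c * ((∫ x, Real.exp (-u * x) ∂ν) - 1))) (u : ℝ) :
    Integrable (fun ω => Real.exp (u * Y ω)) P ∧
      mgf Y P u = Real.exp (c * (mgf id ν u - 1)) := by
  have hd : Differentiable ℂ (complexMGF id ν) := by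
    have := differentiableOn_complexMGF (X := id) (μ := ν)
    simpa [integrableExpSet_id_eq_univ hν, differentiableOn_univ] using this
  obtain ⟨h1, h2⟩ := integrable_exp_mul_of_entire hY hY0
    (H := fun z => Complex.exp (c * (complexMGF id ν z - 1))) (by fun_prop) (fun u hu => by
      have := h (-u) (by linarith)
      simp only [neg_neg] at this
      simp only [complexMGF_ofReal]
      rw [mgf, this, mgf]
      push_cast
      simp) u
  refine ⟨h1, ?_⟩
  simp only [complexMGF_ofReal] at h2
  exact_mod_cast h2

/-- The cumulant-generating function of a drift minus a compound Poisson variable plus an independent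
centred normal variable. -/
theorem cgf_jumpDiffusion {P : Measure Ω} [IsProbabilityMeasure P] {Y W L : Ω → ℝ} {ν : Measure ℝ}
    {a c σ : ℝ} {v : ℝ≥0}
    (hY : ∀ u : ℝ, Integrable (fun ω => Real.exp (u * Y ω)) P ∧
      mgf Y P u = Real.exp (c * (mgf id ν u - 1)))
    (hW : HasLaw W (gaussianReal 0 v) P) (hYW : IndepFun Y W P)
    (hL : L =ᵐ[P] fun ω => a - Y ω + σ * W ω) (u : ℝ) :
    Integrable (fun ω => Real.exp (u * L ω)) P ∧
      cgf L P u = a * u + c * (mgf id ν (-u) - 1) + σ ^ 2 * v / 2 * u ^ 2 := by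
  have hmW : ∀ t, mgf W P t = Real.exp (v * t ^ 2 / 2) := fun t => by
    rw [mgf_gaussianReal hW.map_eq]; simp
  have hiW : ∀ t, Integrable (fun ω => Real.exp (t * W ω)) P := fun t => by
    have := integrable_exp_mul_gaussianReal (μ := 0) (v := v) t
    rw [← hW.map_eq] at this
    exact (integrable_map_measure (by fun_prop) hW.aemeasurable).1 this
  have hi : Integrable (fun ω => Real.exp (-u * Y ω) * Real.exp (u * σ * W ω)) P :=
    (hYW.exp_mul (-u) (u * σ)).integrable_mul (hY (-u)).1 (hiW _)
  have hfun : (fun ω => Real.exp (u * L ω)) =ᵐ[P] fun ω =>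
      Real.exp (a * u) * (Real.exp (-u * Y ω) * Real.exp (u * σ * W ω)) := by
    filter_upwards [hL] with ω h
    rw [h, ← Real.exp_add, ← Real.exp_add]
    ring_nf
  refine ⟨(hi.const_mul _).congr hfun.symm, ?_⟩
  have h2 : ∫ ω, Real.exp (-u * Y ω) * Real.exp (u * σ * W ω) ∂P = mgf Y P (-u) * mgf W P (u * σ) :=
    (hYW.exp_mul (-u) (u * σ)).integral_fun_mul_eq_mul_integral (hY (-u)).1.aestronglyMeasurable
      (hiW _).aestronglyMeasurable
  rw [cgf, mgf, integral_congr_ae hfun, integral_const_mul, h2, (hY (-u)).2, hmW, ← Real.exp_add,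
    ← Real.exp_add, Real.log_exp]
  ring

theorem iteratedDeriv_jumpDiffusion_cgf {ν : Measure ℝ} [IsFiniteMeasure ν] {G : ℝ}
    (hν : ∀ᵐ x ∂ν, x ∈ Icc 0 G) (a c d : ℝ) (m : ℕ) :
    iteratedDeriv m (fun u : ℝ => a * u + c * (mgf id ν (-u) - 1) + d * u ^ 2) 0 =
      a * (if m = 1 then 1 else 0) +
        c * ((-1) ^ m * (∫ x, x ^ m ∂ν) - if m = 0 then 1 else 0) +
        d * (if m = 2 then 2 else 0) := by
  have h0 : (0 : ℝ) ∈ interior (integrableExpSet id ν) := by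
    simp [integrableExpSet_id_eq_univ hν]
  have hF : AnalyticAt ℝ (mgf id ν) (-0) := by
    rw [neg_zero]; exact analyticAt_mgf h0
  have hneg : ContDiffAt ℝ m (fun u : ℝ => mgf id ν (-u)) 0 :=
    (hF.comp (g := mgf id ν) (f := fun u : ℝ => -u) (by fun_prop)).contDiffAt
  have h1 : iteratedDeriv m (fun u : ℝ => mgf id ν (-u)) 0 = (-1) ^ m * ∫ x, x ^ m ∂ν := by
    rw [iteratedDeriv_comp_neg, neg_zero, iteratedDeriv_mgf_zero h0]
    simp
  rw [iteratedDeriv_fun_add (by fun_prop) (by fun_prop), iteratedDeriv_fun_add (by fun_prop)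
    (by fun_prop), iteratedDeriv_const_mul_field, iteratedDeriv_const_mul_field,
    iteratedDeriv_const_mul_field, iteratedDeriv_fun_sub hneg (by fun_prop), h1,
    iteratedDeriv_fun_pow_zero, iteratedDeriv_const]
  have := iteratedDeriv_fun_pow_zero (𝕜 := ℝ) (n := m) (m := 1)
  simp only [pow_one] at this
  rw [this]
  simp

end Laplace

/-! ### Iterated weighted integrals of paths -/

open Filter Topology

/-- Weighted cumulation of a path, `t ↦ c t * ∫_0^t f`. -/
noncomputable def weightedIntegral (c f : ℝ≥0 → ℝ) (t : ℝ≥0) : ℝ :=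
  c t * ∫ s in (0 : ℝ)..t, f s.toNNReal

/-- Measurable and locally bounded paths. -/
structure LocallyBounded (f : ℝ≥0 → ℝ) : Prop where
  measurable : Measurable f
  bounded : ∀ t, ∃ B, ∀ s ≤ t, |f s| ≤ B

/-- Weights for which `weightedIntegral` preserves local boundedness. -/
structure IsAveragingWeight (c : ℝ≥0 → ℝ) : Prop where
  measurable : Measurable c
  nonneg : ∀ t, 0 ≤ c t
  mul_le : ∀ t, c t * t ≤ 1 + t

theorem isAveragingWeight_inv : IsAveragingWeight fun t => (t : ℝ)⁻¹ where
  measurable := by fun_prop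
  nonneg t := by positivity
  mul_le t := by
    rcases eq_or_ne (t : ℝ) 0 with h | h
    · simp [h]
    · rw [inv_mul_cancel₀ h]; simp

theorem isAveragingWeight_one : IsAveragingWeight fun _ => 1 where
  measurable := by fun_prop
  nonneg t := zero_le_one
  mul_le t := by simp

theorem LocallyBounded.intervalIntegrable {f : ℝ≥0 → ℝ} (hf : LocallyBounded f) (a b : ℝ) :
    IntervalIntegrable (fun s : ℝ => f s.toNNReal) volume a b := by
  obtain ⟨B, hB⟩ := hf.bounded (max a b).toNNReal
  refine (intervalIntegrable_const (c := B)).mono_fun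
    (hf.measurable.comp measurable_real_toNNReal).aestronglyMeasurable ?_
  filter_upwards [ae_restrict_mem measurableSet_uIoc] with s hs
  have : |f s.toNNReal| ≤ B := hB _ (Real.toNNReal_le_toNNReal hs.2)
  exact this.trans (le_abs_self B)

theorem abs_integral_path_le {f : ℝ≥0 → ℝ} {t : ℝ≥0} {B : ℝ} (hB : ∀ s ≤ t, |f s| ≤ B) :
    |∫ s in (0 : ℝ)..t, f s.toNNReal| ≤ B * t := by
  have := intervalIntegral.norm_integral_le_of_norm_le_const (a := (0 : ℝ)) (b := t) (C := B)
    (f := fun s : ℝ => f s.toNNReal) (fun s hs => hB _ (by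
      rw [uIoc_of_le (NNReal.coe_nonneg t)] at hs
      exact Real.toNNReal_le_iff_le_coe.2 hs.2))
  simpa using this

/-- The factor `1 + t` covers both weights, as `c s * s` is at most `1` for the running average and
equals `s` for plain cumulation. Uniformity in `s ≤ t` lets the bound be iterated. -/
theorem IsAveragingWeight.abs_weightedIntegral_le {c f : ℝ≥0 → ℝ} (hc : IsAveragingWeight c)
    {t : ℝ≥0} {B : ℝ} (hB : ∀ s ≤ t, |f s| ≤ B) {s : ℝ≥0} (hs : s ≤ t) :
    |weightedIntegral c f s| ≤ B * (1 + t) := by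
  have hB0 : 0 ≤ B := (abs_nonneg _).trans (hB s hs)
  have h1 := abs_integral_path_le (f := f) (t := s) (B := B) fun r hr => hB r (hr.trans hs)
  have h2 : (s : ℝ) ≤ t := by exact_mod_cast hs
  rw [weightedIntegral, abs_mul, abs_of_nonneg (hc.nonneg s)]
  calc c s * _ ≤ c s * (B * s) := mul_le_mul_of_nonneg_left h1 (hc.nonneg s)
    _ = B * (c s * s) := by ring
    _ ≤ B * (1 + s) := mul_le_mul_of_nonneg_left (hc.mul_le s) hB0
    _ ≤ B * (1 + t) := by gcongr

theorem LocallyBounded.weightedIntegral {c f : ℝ≥0 → ℝ} (hf : LocallyBounded f)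
    (hc : IsAveragingWeight c) : LocallyBounded (weightedIntegral c f) where
  measurable := by
    have := (intervalIntegral.continuous_primitive hf.intervalIntegrable 0).measurable
    exact hc.measurable.mul (this.comp measurable_coe_nnreal_real)
  bounded t := by
    obtain ⟨B, hB⟩ := hf.bounded t
    exact ⟨_, fun s hs => hc.abs_weightedIntegral_le hB hs⟩

theorem LocallyBounded.iterate {c f : ℝ≥0 → ℝ} (hf : LocallyBounded f)
    (hc : IsAveragingWeight c) (k : ℕ) : LocallyBounded ((ClockRegulation.weightedIntegral c)^[k] f) := by
  induction k with
  | zero => exact hf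
  | succ k ih => rw [Function.iterate_succ_apply']; exact ih.weightedIntegral hc

theorem iterate_weightedIntegral_sum {c : ℝ≥0 → ℝ} (hc : IsAveragingWeight c) (k : ℕ)
    {ι : Type*} (S : Finset ι) (a : ι → ℝ) {f : ι → ℝ≥0 → ℝ} (hf : ∀ i, LocallyBounded (f i)) :
    (weightedIntegral c)^[k] (fun s => ∑ i ∈ S, a i * f i s) =
      fun s => ∑ i ∈ S, a i * (weightedIntegral c)^[k] (f i) s := by
  induction k with
  | zero => rfl
  | succ k ih =>
    simp only [Function.iterate_succ_apply', ih]
    funext t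
    simp only [weightedIntegral]
    rw [intervalIntegral.integral_finsetSum fun i _ =>
      (((hf i).iterate hc k).intervalIntegrable 0 t).const_mul (a i), Finset.mul_sum]
    refine Finset.sum_congr rfl fun i _ => ?_
    rw [intervalIntegral.integral_const_mul]
    ring

theorem iterate_weightedIntegral_mono {c : ℝ≥0 → ℝ} (hc : IsAveragingWeight c) (k : ℕ)
    {f h : ℝ≥0 → ℝ} (hf : LocallyBounded f) (hh : LocallyBounded h) (hfh : ∀ s, f s ≤ h s)
    (s : ℝ≥0) : (weightedIntegral c)^[k] f s ≤ (weightedIntegral c)^[k] h s := by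
  induction k generalizing s with
  | zero => exact hfh s
  | succ k ih =>
    simp only [Function.iterate_succ_apply']
    refine mul_le_mul_of_nonneg_left ?_ (hc.nonneg s)
    exact intervalIntegral.integral_mono_on s.2 ((hf.iterate hc k).intervalIntegrable _ _)
      ((hh.iterate hc k).intervalIntegrable _ _) fun x _ => ih _

theorem tendsto_weightedIntegral {c : ℝ≥0 → ℝ} {f : ℕ → ℝ≥0 → ℝ}
    {h : ℝ≥0 → ℝ} {t : ℝ≥0} {B : ℝ} (hf : ∀ N, LocallyBounded (f N))
    (hB : ∀ N, ∀ s ≤ t, |f N s| ≤ B) (hlim : ∀ s ≤ t, Tendsto (fun N => f N s) atTop (𝓝 (h s))) :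
    ∀ s ≤ t, Tendsto (fun N => weightedIntegral c (f N) s) atTop (𝓝 (weightedIntegral c h s)) := by
  intro s hs
  refine Tendsto.const_mul _ ?_
  have hmem : ∀ r ∈ uIoc (0 : ℝ) s, r.toNNReal ≤ t := fun r hr => by
    rw [uIoc_of_le (NNReal.coe_nonneg s)] at hr
    exact (Real.toNNReal_le_iff_le_coe.2 hr.2).trans hs
  refine intervalIntegral.tendsto_integral_filter_of_dominated_convergence (fun _ => B) ?_ ?_
    intervalIntegrable_const ?_
  · exact .of_forall fun N => ((hf N).measurable.comp measurable_real_toNNReal).aestronglyMeasurable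
  · exact .of_forall fun N => .of_forall fun r hr => hB N _ (hmem r hr)
  · exact .of_forall fun r hr => hlim _ (hmem r hr)

/-- Dominated convergence, once per integration. The induction removes the innermost integration, so
the sequence, its limit and the bound all have to vary. -/
theorem tendsto_iterate_weightedIntegral {c : ℝ≥0 → ℝ} (hc : IsAveragingWeight c) (k : ℕ)
    {f : ℕ → ℝ≥0 → ℝ} {h : ℝ≥0 → ℝ} {t : ℝ≥0} {B : ℝ} (hf : ∀ N, LocallyBounded (f N))
    (hB : ∀ N, ∀ s ≤ t, |f N s| ≤ B) (hlim : ∀ s ≤ t, Tendsto (fun N => f N s) atTop (𝓝 (h s))) :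
    ∀ s ≤ t, Tendsto (fun N => (weightedIntegral c)^[k] (f N) s) atTop
      (𝓝 ((weightedIntegral c)^[k] h s)) := by
  induction k generalizing f h B with
  | zero => exact hlim
  | succ k ih =>
    simp only [Function.iterate_succ_apply]
    exact ih (fun N => (hf N).weightedIntegral hc)
      (fun N s hs => hc.abs_weightedIntegral_le (hB N) hs) (tendsto_weightedIntegral hf hB hlim)

/-! ### Approximation of subordinator paths by steps on a grid -/

/-- The unit step at `a`. -/
noncomputable def unitStep (a : ℝ≥0) : ℝ≥0 → ℝ := (Ioi a).indicator 1

theorem locallyBounded_unitStep (a : ℝ≥0) : LocallyBounded (unitStep a) where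
  measurable := measurable_one.indicator measurableSet_Ioi
  bounded _ := ⟨1, fun s _ => by
    by_cases h : s ∈ Ioi a <;> simp [unitStep, h]⟩

/-- Points of the equidistant grid on `[0, t]`. -/
noncomputable def gridPoint (t : ℝ≥0) (N i : ℕ) : ℝ≥0 := t * i / N

theorem gridPoint_succ (t : ℝ≥0) (N i : ℕ) :
    gridPoint t N (i + 1) = gridPoint t N i + t / N := by
  simp only [gridPoint]; push_cast; ring

theorem monotone_gridPoint (t : ℝ≥0) (N : ℕ) : Monotone (gridPoint t N) :=
  monotone_nat_of_le_succ fun i => by rw [gridPoint_succ]; simp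

theorem exists_gridPoint {t s : ℝ≥0} (ht : 0 < t) (hs : s ≤ t) {N : ℕ} (hN : 0 < N) :
    ∃ j ≤ N, (∀ i, gridPoint t N i < s ↔ i < j) ∧ s ≤ gridPoint t N j ∧
      gridPoint t N j ≤ s + t / N := by
  have hN' : (0 : ℝ≥0) < N := by exact_mod_cast hN
  have hlt : ∀ i : ℕ, gridPoint t N i < s ↔ i < ⌈s * N / t⌉₊ := fun i => by
    rw [Nat.lt_ceil, gridPoint, div_lt_iff₀ hN', lt_div_iff₀ ht, mul_comm t]
  refine ⟨⌈s * N / t⌉₊, ?_, hlt, not_lt.1 fun h => lt_irrefl _ ((hlt _).1 h), ?_⟩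
  · rw [Nat.ceil_le, div_le_iff₀ ht, mul_comm (N : ℝ≥0)]
    gcongr
  · rcases Nat.eq_zero_or_pos ⌈s * N / t⌉₊ with h | h
    · rw [h]; simp [gridPoint]
    · obtain ⟨j, hj⟩ := Nat.exists_eq_succ_of_ne_zero h.ne'
      have := (hlt j).2 (by omega)
      rw [hj, Nat.succ_eq_add_one, gridPoint_succ]
      gcongr

/-- Approximation of a path on `[0, t]` by a step function. -/
noncomputable def stepApprox (z : ℝ≥0 → ℝ) (t : ℝ≥0) (N : ℕ) (s : ℝ≥0) : ℝ :=
  ∑ i ∈ Finset.range N, (z (gridPoint t N (i + 1)) - z (gridPoint t N i)) *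
    unitStep (gridPoint t N i) s

theorem locallyBounded_stepApprox (z : ℝ≥0 → ℝ) (t : ℝ≥0) (N : ℕ) :
    LocallyBounded (stepApprox z t N) where
  measurable := by
    unfold stepApprox
    exact Finset.measurable_fun_sum _ fun i _ =>
      (locallyBounded_unitStep _).measurable.const_mul _
  bounded _ := ⟨∑ i ∈ Finset.range N, |z (gridPoint t N (i + 1)) - z (gridPoint t N i)|, fun s _ => by
    refine (Finset.abs_sum_le_sum_abs _ _).trans (Finset.sum_le_sum fun i _ => ?_)
    rw [abs_mul]
    refine mul_le_of_le_one_right (abs_nonneg _) ?_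
    by_cases h : s ∈ Ioi (gridPoint t N i) <;> simp [unitStep, h]⟩

/-- The sum telescopes. A unit step vanishes at its own location, so exactly the grid points
strictly below `s` contribute, and the value is that of `z` at the first grid point not below `s`.
Approximation is thus from the right. -/
theorem exists_stepApprox_eq {z : ℝ≥0 → ℝ} (hz : z 0 = 0) {t s : ℝ≥0} (ht : 0 < t) (hs : s ≤ t)
    {N : ℕ} (hN : 0 < N) :
    ∃ r, s ≤ r ∧ r ≤ s + t / N ∧ r ≤ t ∧ stepApprox z t N s = z r := by
  obtain ⟨j, hjN, hj, h1, h2⟩ := exists_gridPoint ht hs hN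
  refine ⟨gridPoint t N j, h1, h2, ?_, ?_⟩
  · refine (monotone_gridPoint t N hjN).trans_eq ?_
    have : (N : ℝ≥0) ≠ 0 := by exact_mod_cast hN.ne'
    rw [gridPoint, mul_div_cancel_right₀ _ this]
  · have : stepApprox z t N s = ∑ i ∈ Finset.range N,
        if i < j then z (gridPoint t N (i + 1)) - z (gridPoint t N i) else 0 := by
      refine Finset.sum_congr rfl fun i _ => ?_
      by_cases h : i < j <;> simp [unitStep, hj, h]
    rw [this, ← Finset.sum_filter]
    have hfil : (Finset.range N).filter (· < j) = Finset.range j := by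
      ext i; simp; omega
    rw [hfil, Finset.sum_range_sub (fun i => z (gridPoint t N i))]
    simp [gridPoint, hz]

theorem abs_stepApprox_le {z : ℝ≥0 → ℝ} (hz : z 0 = 0) (hm : Monotone z) {t s : ℝ≥0} (ht : 0 < t)
    (hs : s ≤ t) (N : ℕ) : |stepApprox z t N s| ≤ z t := by
  have h0 : ∀ r, 0 ≤ z r := fun r => hz ▸ hm zero_le
  rcases Nat.eq_zero_or_pos N with rfl | hN
  · simpa [stepApprox] using h0 t
  · obtain ⟨r, -, -, h3, h4⟩ := exists_stepApprox_eq hz ht hs hN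
    rw [h4, abs_of_nonneg (h0 r)]
    exact hm h3

theorem tendsto_stepApprox {z : ℝ≥0 → ℝ} (hz : z 0 = 0) {t s : ℝ≥0}
    (hc : ContinuousWithinAt z (Ici s) s) (ht : 0 < t) (hs : s ≤ t) :
    Tendsto (fun N => stepApprox z t N s) atTop (𝓝 (z s)) := by
  have hex : ∀ N : ℕ, ∃ r, s ≤ r ∧ (0 < N → r ≤ s + t / N ∧ stepApprox z t N s = z r) := fun N => by
    rcases Nat.eq_zero_or_pos N with rfl | hN
    · exact ⟨s, le_rfl, fun h => absurd h (lt_irrefl 0)⟩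
    · obtain ⟨r, h1, h2, -, h4⟩ := exists_stepApprox_eq hz ht hs hN
      exact ⟨r, h1, fun _ => ⟨h2, h4⟩⟩
  choose r hr1 hr2 using hex
  have hlim : Tendsto r atTop (𝓝 s) := by
    have hup : Tendsto (fun N : ℕ => s + t / (N : ℝ≥0)) atTop (𝓝 s) := by
      have h1 : Tendsto (fun N : ℕ => t / (N : ℝ≥0)) atTop (𝓝 0) := by
        rw [← NNReal.tendsto_coe]
        simpa using tendsto_const_div_atTop_nhds_zero_nat (t : ℝ)
      simpa using h1.const_add s
    refine tendsto_of_tendsto_of_tendsto_of_le_of_le' tendsto_const_nhds hup (.of_forall hr1) ?_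
    filter_upwards [eventually_gt_atTop 0] with N hN using (hr2 N hN).1
  have h2 : Tendsto (fun N => z (r N)) atTop (𝓝 (z s)) :=
    hc.tendsto.comp (tendsto_nhdsWithin_iff.2 ⟨hlim, .of_forall hr1⟩)
  refine h2.congr' ?_
  filter_upwards [eventually_gt_atTop 0] with N hN using (hr2 N hN).2.symm

/-- Iterated weighted integrals of a monotone right-continuous path are limits of linear
combinations of its increments. -/
theorem tendsto_sum_increments {c z : ℝ≥0 → ℝ} (hcw : IsAveragingWeight c) (k : ℕ) (hz : z 0 = 0)
    (hm : Monotone z) (hrc : ∀ s, ContinuousWithinAt z (Ici s) s) {t : ℝ≥0} (ht : 0 < t) :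
    Tendsto (fun N => ∑ i ∈ Finset.range N, (z (gridPoint t N (i + 1)) - z (gridPoint t N i)) *
      (weightedIntegral c)^[k] (unitStep (gridPoint t N i)) t) atTop
      (𝓝 ((weightedIntegral c)^[k] z t)) := by
  have h := tendsto_iterate_weightedIntegral hcw k (locallyBounded_stepApprox z t)
    (fun N s hs => abs_stepApprox_le hz hm ht hs N)
    (fun s hs => tendsto_stepApprox hz (hrc s) ht hs) t le_rfl
  refine h.congr fun N => ?_
  unfold stepApprox
  rw [iterate_weightedIntegral_sum hcw k _ _ fun i => locallyBounded_unitStep _]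

/-- Convergence of Riemann sums of monotone functions. -/
theorem tendsto_riemannSum_of_monotoneOn {h : ℝ → ℝ} (hh : MonotoneOn h (Icc 0 1)) :
    Tendsto (fun N : ℕ => (N : ℝ)⁻¹ * ∑ i ∈ Finset.range N, h (i / N)) atTop
      (𝓝 (∫ x in (0 : ℝ)..1, h x)) := by
  have hlow : Tendsto (fun N : ℕ => (∫ x in (0 : ℝ)..1, h x) - (N : ℝ)⁻¹ * (h 1 - h 0)) atTop
      (𝓝 (∫ x in (0 : ℝ)..1, h x)) := by
    have := (tendsto_inv_atTop_nhds_zero_nat (𝕜 := ℝ)).mul_const (h 1 - h 0)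
    simpa using this.const_sub (∫ x in (0 : ℝ)..1, h x)
  -- Left-endpoint sums underestimate the integral of an increasing function, and right-endpoint
  -- sums exceed them by the telescoping amount `h 1 - h 0`. No continuity is needed.
  have key : ∀ N : ℕ, 0 < N →
      ∑ i ∈ Finset.range N, h (i / N) ≤ N * ∫ x in (0 : ℝ)..1, h x ∧
        N * ∫ x in (0 : ℝ)..1, h x ≤ ∑ i ∈ Finset.range N, h (i / N) + (h 1 - h 0) := by
    intro N hN
    have hN' : (0 : ℝ) < N := by exact_mod_cast hN
    have hmono : MonotoneOn (fun x : ℝ => h (x / N)) (Icc (0 : ℝ) (0 + N)) := by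
      intro x hx y hy hxy
      rw [zero_add] at hx hy
      exact hh ⟨div_nonneg hx.1 hN'.le, (div_le_one hN').2 hx.2⟩
        ⟨div_nonneg hy.1 hN'.le, (div_le_one hN').2 hy.2⟩ (by gcongr)
    have h1 := hmono.sum_le_integral
    have h2 := hmono.integral_le_sum
    have h3 : ∫ x in (0 : ℝ)..N, h (x / N) = N * ∫ x in (0 : ℝ)..1, h x := by
      rw [intervalIntegral.integral_comp_div h hN'.ne']
      simp [div_self hN'.ne']
    simp only [zero_add, h3] at h1 h2
    refine ⟨h1, h2.trans_eq ?_⟩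
    have := Finset.sum_range_sub (fun i : ℕ => h (i / N)) N
    rw [Finset.sum_sub_distrib] at this
    rw [← sub_eq_iff_eq_add', this]
    simp [div_self hN'.ne']
  refine tendsto_of_tendsto_of_tendsto_of_le_of_le' hlow tendsto_const_nhds ?_ ?_
  · filter_upwards [eventually_gt_atTop 0] with N hN
    have hN' : (0 : ℝ) < N := by exact_mod_cast hN
    rw [sub_le_iff_le_add, ← mul_add, ← div_eq_inv_mul, le_div_iff₀ hN', mul_comm]
    exact (key N hN).2
  · filter_upwards [eventually_gt_atTop 0] with N hN
    have hN' : (0 : ℝ) < N := by exact_mod_cast hN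
    rw [← div_eq_inv_mul, div_le_iff₀ hN', mul_comm]
    exact (key N hN).1

theorem iterate_weightedIntegral_unitStep_nonneg {c : ℝ≥0 → ℝ} (hc : IsAveragingWeight c) (k : ℕ)
    (a t : ℝ≥0) : 0 ≤ (weightedIntegral c)^[k] (unitStep a) t := by
  -- The empty linear combination shows that the zero path is mapped to zero, which reduces the
  -- claim to monotonicity.
  have h0 := congrFun (iterate_weightedIntegral_sum hc k (∅ : Finset ℕ) 0
    fun _ => locallyBounded_unitStep 0) t
  simp only [Finset.sum_empty] at h0
  rw [← h0]
  refine iterate_weightedIntegral_mono hc k ⟨measurable_const, fun _ => ⟨0, by simp⟩⟩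
    (locallyBounded_unitStep a) (fun s => ?_) t
  exact indicator_nonneg (fun _ _ => zero_le_one) s

theorem iterate_weightedIntegral_unitStep_anti {c : ℝ≥0 → ℝ} (hc : IsAveragingWeight c) (k : ℕ)
    {a b : ℝ≥0} (hab : a ≤ b) (t : ℝ≥0) :
    (weightedIntegral c)^[k] (unitStep b) t ≤ (weightedIntegral c)^[k] (unitStep a) t := by
  refine iterate_weightedIntegral_mono hc k (locallyBounded_unitStep b)
    (locallyBounded_unitStep a) (fun s => ?_) t
  exact indicator_le_indicator_of_subset (Ioi_subset_Ioi hab) (fun _ => zero_le_one) s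

/-! ### Laplace transforms of iterated integrals of a subordinator -/

section Processes

variable {Ω : Type*} [MeasurableSpace Ω] {P : Measure Ω}

theorem IsSubordinator.nonneg {Z : ℝ≥0 → Ω → ℝ} (hZ : IsSubordinator Z P) (t : ℝ≥0) :
    ∀ᵐ ω ∂P, 0 ≤ Z t ω := by
  filter_upwards [hZ.zero, hZ.mono] with ω h0 hm
  exact h0 ▸ hm zero_le

/-- The increments over the grid are independent and distributed as `Z (t / N)`, so the expectation
factors and each factor contributes `(t / N) * ψ (a i)` to the exponent. -/
theorem IsSubordinator.integral_exp_increments [IsProbabilityMeasure P] {Z : ℝ≥0 → Ω → ℝ}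
    (hZ : IsSubordinator Z P) {ψ : ℝ → ℝ}
    (hψ : ∀ (s : ℝ≥0) (u : ℝ), 0 ≤ u → ∫ ω, Real.exp (-u * Z s ω) ∂P = Real.exp (s * ψ u))
    (t : ℝ≥0) (N : ℕ) {a : ℕ → ℝ} (ha : ∀ i, 0 ≤ a i) :
    ∫ ω, Real.exp (-∑ i ∈ Finset.range N,
        (Z (gridPoint t N (i + 1)) ω - Z (gridPoint t N i) ω) * a i) ∂P =
      Real.exp (t * ((N : ℝ)⁻¹ * ∑ i ∈ Finset.range N, ψ (a i))) := by
  set D : ℕ → Ω → ℝ := fun i ω => Z (gridPoint t N (i + 1)) ω - Z (gridPoint t N i) ω with hD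
  have hind : iIndepFun D P := hZ.indep.nat (monotone_gridPoint t N)
  have hmeas : ∀ i, AEMeasurable (D i) P := fun i => (hZ.aemeasurable _).sub (hZ.aemeasurable _)
  set X : ℕ → Ω → ℝ := fun i ω => D i ω * a i with hX
  have hXind : iIndepFun X P := hind.comp (fun i x => x * a i) fun i => measurable_mul_const _
  have hXmeas : ∀ i, AEMeasurable (X i) P := fun i => (hmeas i).mul_const _
  have h1 := hXind.mgf_sum₀ (t := -1) hXmeas (Finset.range N)
  have h2 : ∀ i, mgf (X i) P (-1) = Real.exp (t * ((N : ℝ)⁻¹ * ψ (a i))) := fun i => by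
    have hid : IdentDistrib (D i) (Z (t / N)) P P := by
      have := hZ.stationary (gridPoint t N i) (t / N)
      rwa [← gridPoint_succ] at this
    have := (hid.comp (u := fun x => Real.exp (-a i * x)) (by fun_prop)).integral_eq
    simp only [Function.comp_def] at this
    rw [hψ _ _ (ha i)] at this
    have hexp : (t : ℝ) * ((N : ℝ)⁻¹ * ψ (a i)) = ((t / N : ℝ≥0) : ℝ) * ψ (a i) := by
      push_cast; ring
    rw [mgf, hexp, ← this]
    congr 1 with ω
    simp only [hX]
    ring_nf
  rw [Finset.prod_congr rfl fun i _ => h2 i, ← Real.exp_sum] at h1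
  rw [Finset.mul_sum, Finset.mul_sum, ← h1, mgf]
  congr 1 with ω
  simp [hX, hD]

/-- Laplace transform of an iterated weighted integral of a subordinator, where `g` describes the
effect of the integrations on unit steps. -/
theorem IsSubordinator.integral_exp_iterate [IsProbabilityMeasure P] {Z : ℝ≥0 → Ω → ℝ}
    (hZ : IsSubordinator Z P) {ψ : ℝ → ℝ} (hanti : AntitoneOn ψ (Ici 0))
    (hψ : ∀ (s : ℝ≥0) (u : ℝ), 0 ≤ u → ∫ ω, Real.exp (-u * Z s ω) ∂P = Real.exp (s * ψ u))
    {c : ℝ≥0 → ℝ} (hc : IsAveragingWeight c) (k : ℕ) {t : ℝ≥0} (ht : 0 < t) {g : ℝ → ℝ}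
    (hg : ∀ a : ℝ≥0, a ≤ t → (weightedIntegral c)^[k] (unitStep a) t = g (a / t))
    {u : ℝ} (hu : 0 ≤ u) :
    ∫ ω, Real.exp (-u * (weightedIntegral c)^[k] (fun s => Z s ω) t) ∂P =
      Real.exp (t * ∫ s in (0 : ℝ)..1, ψ (u * g s)) := by
  have ht' : (0 : ℝ) < t := by exact_mod_cast ht
  have hgx : ∀ x ∈ Icc (0 : ℝ) 1,
      g x = (weightedIntegral c)^[k] (unitStep (t * x.toNNReal)) t := fun x hx => by
    rw [hg _ (mul_le_of_le_one_right t.2 (Real.toNNReal_le_one.2 hx.2))]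
    congr 1
    push_cast
    rw [Real.coe_toNNReal x hx.1, mul_div_cancel_left₀ _ ht'.ne']
  have hg0 : ∀ x ∈ Icc (0 : ℝ) 1, 0 ≤ g x := fun x hx => by
    rw [hgx x hx]; exact iterate_weightedIntegral_unitStep_nonneg hc k _ t
  -- A later step has less effect, so `g` decreases; `ψ` decreases as well, hence the composition
  -- increases.
  have hmono : MonotoneOn (fun s => ψ (u * g s)) (Icc 0 1) := fun x hx y hy hxy => by
    refine hanti (mul_nonneg hu (hg0 y hy)) (mul_nonneg hu (hg0 x hx))
      (mul_le_mul_of_nonneg_left ?_ hu)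
    rw [hgx x hx, hgx y hy]
    exact iterate_weightedIntegral_unitStep_anti hc k (by gcongr) t
  have hR := ((tendsto_riemannSum_of_monotoneOn hmono).const_mul (t : ℝ)).rexp
  set w : ℕ → ℕ → ℝ := fun N i => (weightedIntegral c)^[k] (unitStep (gridPoint t N i)) t with hw
  have hw0 : ∀ N i, 0 ≤ w N i := fun N i => iterate_weightedIntegral_unitStep_nonneg hc k _ t
  have hL : Tendsto (fun N => ∫ ω, Real.exp (-∑ i ∈ Finset.range N,
      (Z (gridPoint t N (i + 1)) ω - Z (gridPoint t N i) ω) * (u * w N i)) ∂P) atTop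
      (𝓝 (∫ ω, Real.exp (-u * (weightedIntegral c)^[k] (fun s => Z s ω) t) ∂P)) := by
    refine tendsto_integral_of_dominated_convergence (fun _ => 1) (fun N => ?_)
      (integrable_const 1) (fun N => ?_) ?_
    · have := hZ.aemeasurable
      exact (Real.measurable_exp.comp_aemeasurable (Finset.aemeasurable_fun_sum _ fun i _ =>
        ((this _).sub (this _)).mul_const _).neg).aestronglyMeasurable
    · filter_upwards [hZ.mono] with ω hm
      rw [Real.norm_of_nonneg (Real.exp_pos _).le, Real.exp_le_one_iff, neg_nonpos]
      exact Finset.sum_nonneg fun i _ => mul_nonneg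
        (sub_nonneg.2 (hm (monotone_gridPoint t N (Nat.le_succ i)))) (mul_nonneg hu (hw0 N i))
    · filter_upwards [hZ.zero, hZ.mono, hZ.rightCont] with ω h0 hm hrc
      have := ((tendsto_sum_increments hc k h0 hm hrc ht).const_mul (-u)).rexp
      refine this.congr fun N => ?_
      rw [Finset.mul_sum, ← Finset.sum_neg_distrib]
      congr 1
      refine Finset.sum_congr rfl fun i _ => ?_
      simp only [hw]
      ring
  -- Both limits are taken along the same sequence, since the grid point `t i / N` corresponds to
  -- the argument `i / N` of `g`.
  refine tendsto_nhds_unique hL (hR.congr fun N => ?_)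
  rw [hZ.integral_exp_increments hψ t N fun i => mul_nonneg hu (hw0 N i)]
  congr 3
  refine Finset.sum_congr rfl fun i hi => ?_
  have hiN := Finset.mem_range.1 hi
  have hN : (0 : ℝ≥0) < N := by exact_mod_cast (Nat.zero_le i).trans_lt hiN
  simp only [hw]
  rw [hg]
  · congr 3
    simp only [gridPoint]
    push_cast
    field_simp
  · rw [gridPoint, div_le_iff₀ hN]
    gcongr

end Processes

/-! ### Effect of averaging and cumulation on unit steps -/

theorem weightedIntegral_eq_zero (c : ℝ≥0 → ℝ) {f : ℝ≥0 → ℝ} {a t : ℝ≥0}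
    (h0 : ∀ s ≤ a, f s = 0) (hta : t ≤ a) : weightedIntegral c f t = 0 := by
  have h := abs_integral_path_le (f := f) (t := t) (B := 0)
    fun s hs => by rw [h0 s (hs.trans hta), abs_zero]
  rw [zero_mul, abs_nonpos_iff] at h
  rw [weightedIntegral, h, mul_zero]

theorem weightedIntegral_eq_integral (c : ℝ≥0 → ℝ) {f : ℝ≥0 → ℝ} {a t : ℝ≥0} {φ : ℝ → ℝ}
    (hf : LocallyBounded f) (h0 : ∀ s ≤ a, f s = 0) (hφ : ∀ s, a < s → f s = φ s) (hat : a ≤ t) :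
    weightedIntegral c f t = c t * ∫ s in (a : ℝ)..t, φ s := by
  have h1 := weightedIntegral_eq_zero (fun _ => 1) h0 le_rfl
  rw [weightedIntegral, one_mul] at h1
  rw [weightedIntegral, ← intervalIntegral.integral_add_adjacent_intervals
    (hf.intervalIntegrable 0 a) (hf.intervalIntegrable a t), h1, zero_add]
  congr 1
  refine intervalIntegral.integral_congr_ae (.of_forall fun s hs => ?_)
  rw [uIoc_of_le (by exact_mod_cast hat)] at hs
  have hs0 : 0 ≤ s := a.2.trans hs.1.le
  rw [hφ _ (Real.lt_toNNReal_iff_coe_lt.2 hs.1), Real.coe_toNNReal s hs0]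

/-- The value at `1` of the `k`-fold running average of the unit step at `x`. -/
noncomputable def averageProfile (k : ℕ) (x : ℝ) : ℝ :=
  1 - x * ∑ j ∈ Finset.range k, (-Real.log x) ^ j / j.factorial

/-- The substituted profile has an explicit antiderivative: differentiating `(log s - log a)^(j+1) /
(j+1)!` lowers the power and produces the factor `1 / s`. The term `j = 0` of the next profile comes
from the lower limit `a`. -/
theorem integral_averageProfile {a t : ℝ} (ha : 0 < a) (hat : a ≤ t) (k : ℕ) :
    ∫ s in a..t, averageProfile k (a / s) = t * averageProfile (k + 1) (a / t) := by
  have ht : 0 < t := ha.trans_le hat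
  have hpos : ∀ s ∈ uIcc a t, 0 < s := fun s hs => by
    rw [uIcc_of_le hat] at hs; exact ha.trans_le hs.1
  have hlog : ∀ s, 0 < s → -Real.log (a / s) = Real.log s - Real.log a := fun s hs => by
    rw [Real.log_div ha.ne' hs.ne']; ring
  have hderiv : ∀ s ∈ uIcc a t, HasDerivAt (fun s : ℝ => s - a * ∑ j ∈ Finset.range k,
      (Real.log s - Real.log a) ^ (j + 1) / (j + 1).factorial) (averageProfile k (a / s)) s := by
    intro s hs
    have hs0 := hpos s hs
    have h1 : HasDerivAt (fun s : ℝ => ∑ j ∈ Finset.range k,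
        (Real.log s - Real.log a) ^ (j + 1) / (j + 1).factorial)
        (∑ j ∈ Finset.range k, (Real.log s - Real.log a) ^ j / j.factorial * s⁻¹) s := by
      refine HasDerivAt.fun_sum fun j _ => ?_
      convert! ((((Real.hasDerivAt_log hs0.ne').sub_const (Real.log a)).pow (j + 1)).div_const
        ((j + 1).factorial : ℝ)) using 1
      rw [Nat.factorial_succ]
      push_cast
      have : ((j : ℝ) + 1) ≠ 0 := by positivity
      field_simp
    convert! (hasDerivAt_id s).sub (h1.const_mul a) using 1
    rw [averageProfile, hlog s hs0, ← Finset.sum_mul]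
    field_simp
  have hcont : ContinuousOn (fun s => averageProfile k (a / s)) (uIcc a t) := by
    intro s hs
    have hs0 := hpos s hs
    have : ContinuousAt (fun s : ℝ => Real.log (a / s)) s :=
      (continuousAt_const.div continuousAt_id hs0.ne').log (div_pos ha hs0).ne'
    have h2 : ContinuousAt (fun s : ℝ => a / s) s := continuousAt_const.div continuousAt_id hs0.ne'
    unfold averageProfile
    exact (ContinuousAt.sub continuousAt_const (h2.mul (tendsto_finsetSum _ fun j _ =>
      ((this.neg.pow j).div_const _)))).continuousWithinAt
  rw [intervalIntegral.integral_eq_sub_of_hasDerivAt hderiv hcont.intervalIntegrable,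
    averageProfile, hlog t ht, Finset.sum_range_succ']
  simp
  field_simp
  ring

theorem iterate_average_unitStep (k : ℕ) (a t : ℝ≥0) :
    (t ≤ a → (weightedIntegral fun r => (r : ℝ)⁻¹)^[k] (unitStep a) t = 0) ∧
      (a < t → (weightedIntegral fun r => (r : ℝ)⁻¹)^[k] (unitStep a) t =
        averageProfile k (a / t)) := by
  induction k generalizing t with
  | zero =>
    refine ⟨fun h => ?_, fun h => ?_⟩
    · simp [unitStep, h]
    · simp [unitStep, h, averageProfile]
  | succ k ih =>
    rw [Function.iterate_succ_apply']
    have h0 : ∀ s ≤ a, (weightedIntegral fun r => (r : ℝ)⁻¹)^[k] (unitStep a) s = 0 :=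
      fun s hs => (ih s).1 hs
    refine ⟨weightedIntegral_eq_zero _ h0, fun hat => ?_⟩
    have ht : (0 : ℝ) < t := by exact_mod_cast zero_le.trans_lt hat
    rw [weightedIntegral_eq_integral (φ := fun s => averageProfile k (a / s)) _
      ((locallyBounded_unitStep a).iterate isAveragingWeight_inv k) h0
      (fun s hs => (ih s).2 hs) hat.le]
    -- At `a = 0` the logarithmic antiderivative is unavailable, but the profile is identically `1`.
    rcases eq_or_ne a 0 with rfl | ha
    · simp [averageProfile, ht.ne']
    · have ha' : (0 : ℝ) < a := by exact_mod_cast pos_iff_ne_zero.2 ha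
      rw [integral_averageProfile ha' (by exact_mod_cast hat.le), inv_mul_cancel_left₀ ht.ne']

theorem iterate_integral_unitStep (k : ℕ) (a t : ℝ≥0) :
    (t ≤ a → (weightedIntegral fun _ => 1)^[k] (unitStep a) t = 0) ∧
      (a < t → (weightedIntegral fun _ => 1)^[k] (unitStep a) t =
        ((t : ℝ) - a) ^ k / k.factorial) := by
  induction k generalizing t with
  | zero =>
    refine ⟨fun h => ?_, fun h => ?_⟩
    · simp [unitStep, h]
    · simp [unitStep, h]
  | succ k ih =>
    rw [Function.iterate_succ_apply']
    have h0 : ∀ s ≤ a, (weightedIntegral fun _ => 1)^[k] (unitStep a) s = 0 :=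
      fun s hs => (ih s).1 hs
    refine ⟨weightedIntegral_eq_zero _ h0, fun hat => ?_⟩
    rw [weightedIntegral_eq_integral (φ := fun s => (s - a) ^ k / k.factorial) _
      ((locallyBounded_unitStep a).iterate isAveragingWeight_one k) h0
      (fun s hs => (ih s).2 hs) hat.le, one_mul, intervalIntegral.integral_div,
      intervalIntegral.integral_comp_sub_right (fun s : ℝ => s ^ k), integral_pow,
      Nat.factorial_succ]
    push_cast
    have : ((k : ℝ) + 1) ≠ 0 := by positivity
    simp
    field_simp

/-! ### The incomplete gamma function -/

theorem integrableOn_gamma {n : ℝ} (hn : 0 < n) :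
    IntegrableOn (fun t : ℝ => t ^ (n - 1) * Real.exp (-t)) (Ioi 0) := by
  simpa [mul_comm] using Real.GammaIntegral_convergent hn

theorem upperGamma_anti {n x y : ℝ} (hn : 0 < n) (hx : 0 ≤ x) (hxy : x ≤ y) :
    upperGamma n y ≤ upperGamma n x := by
  refine setIntegral_mono_set ((integrableOn_gamma hn).mono_set (Ioi_subset_Ioi hx)) ?_
    (Ioi_subset_Ioi hxy).eventuallyLE
  filter_upwards [ae_restrict_mem measurableSet_Ioi] with t ht
  have : 0 < t := hx.trans_lt ht
  simp only [Pi.zero_apply]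
  positivity

theorem upperGamma_zero {n : ℝ} (hn : 0 < n) : upperGamma n 0 = Real.Gamma n := by
  rw [Real.Gamma_eq_integral hn, upperGamma]
  simp [mul_comm]

theorem upperGamma_nonneg {n x : ℝ} (hx : 0 ≤ x) : 0 ≤ upperGamma n x :=
  setIntegral_nonneg measurableSet_Ioi fun t ht => by
    have : 0 < t := hx.trans_lt ht
    positivity

theorem upperGamma_lt {n x : ℝ} (hn : 0 < n) (hx : 0 < x) : upperGamma n x < Real.Gamma n := by
  have hi := integrableOn_gamma hn
  rw [← upperGamma_zero hn, upperGamma, upperGamma, ← Ioc_union_Ioi_eq_Ioi hx.le,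
    setIntegral_union Ioc_disjoint_Ioi_same measurableSet_Ioi
      (hi.mono_set Ioc_subset_Ioi_self) (hi.mono_set (Ioi_subset_Ioi hx.le)),
    lt_add_iff_pos_left, ← intervalIntegral.integral_of_le hx.le]
  refine intervalIntegral.intervalIntegral_pos_of_pos_on ?_ (fun t ht => ?_) hx
  · rw [intervalIntegrable_iff_integrableOn_Ioc_of_le hx.le]
    exact hi.mono_set Ioc_subset_Ioi_self
  · have : 0 < t := ht.1
    positivity

/-- For integer degree the incomplete gamma function is elementary. -/
theorem upperGamma_natCast {k : ℕ} (hk : 0 < k) {y : ℝ} (hy : 0 ≤ y) :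
    upperGamma k y = Real.Gamma k *
      (Real.exp (-y) * ∑ j ∈ Finset.range k, y ^ j / j.factorial) := by
  obtain ⟨k, rfl⟩ := Nat.exists_eq_succ_of_ne_zero hk.ne'
  have hΓ : Real.Gamma ((k + 1 : ℕ) : ℝ) = k.factorial := by
    push_cast; exact Real.Gamma_nat_eq_factorial k
  -- Differentiating the truncated exponential series times `e^(-t)` cancels all terms except the
  -- top one, `t^k / k!`.
  have hderiv : ∀ t : ℝ, HasDerivAt (fun t : ℝ => -((k.factorial : ℝ) *
      (Real.exp (-t) * ∑ j ∈ Finset.range (k + 1), t ^ j / j.factorial)))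
      (t ^ (((k + 1 : ℕ) : ℝ) - 1) * Real.exp (-t)) t := by
    intro t
    have h1 : HasDerivAt (fun s : ℝ => ∑ j ∈ Finset.range (k + 1), s ^ j / j.factorial)
        (∑ j ∈ Finset.range k, t ^ j / j.factorial) t := by
      simp only [Finset.sum_range_succ']
      have : HasDerivAt (fun s : ℝ => ∑ j ∈ Finset.range k, s ^ (j + 1) / (j + 1).factorial)
          (∑ j ∈ Finset.range k, t ^ j / j.factorial) t := by
        refine HasDerivAt.fun_sum fun j _ => ?_
        convert! (hasDerivAt_pow (j + 1) t).div_const ((j + 1).factorial : ℝ) using 1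
        rw [Nat.factorial_succ]
        push_cast
        have : ((j : ℝ) + 1) ≠ 0 := by positivity
        field_simp
      simpa using this.add_const (t ^ 0 / ((0 : ℕ).factorial : ℝ))
    convert! (((hasDerivAt_neg t).exp.mul h1).const_mul (k.factorial : ℝ)).neg using 1
    have h2 : t ^ (((k + 1 : ℕ) : ℝ) - 1) = t ^ k := by
      push_cast; rw [add_sub_cancel_right, Real.rpow_natCast]
    have : (k.factorial : ℝ) ≠ 0 := by positivity
    rw [h2, Finset.sum_range_succ]
    field_simp
    ring
  have hlim : Tendsto (fun t : ℝ => -((k.factorial : ℝ) *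
      (Real.exp (-t) * ∑ j ∈ Finset.range (k + 1), t ^ j / j.factorial))) atTop (𝓝 0) := by
    have : Tendsto (fun t : ℝ => ∑ j ∈ Finset.range (k + 1),
        t ^ j * Real.exp (-t) / j.factorial) atTop (𝓝 (∑ j ∈ Finset.range (k + 1),
          0 / (j.factorial : ℝ))) :=
      tendsto_finsetSum _ fun j _ =>
        (Real.tendsto_pow_mul_exp_neg_atTop_nhds_zero j).div_const _
    simp only [zero_div, Finset.sum_const_zero] at this
    have h2 := (this.const_mul (k.factorial : ℝ)).neg
    rw [mul_zero, neg_zero] at h2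
    refine h2.congr fun t => ?_
    rw [Finset.mul_sum _ _ (Real.exp (-t))]
    congr 2
    exact Finset.sum_congr rfl fun j _ => by ring
  have := integral_Ioi_of_hasDerivAt_of_tendsto' (a := y) (fun t _ => hderiv t)
    ((integrableOn_gamma (by positivity)).mono_set (Ioi_subset_Ioi hy)) hlim
  rw [Nat.succ_eq_add_one, upperGamma, this, hΓ]
  ring

/-- The regulating profile `1 - Γ(n, -log s) / Γ(n)` of type I. -/
noncomputable def gammaProfile (n s : ℝ) : ℝ := 1 - upperGamma n (-Real.log s) / Real.Gamma n

/-- This links the integer recipe of type I to the formula for real degree, since `e^(-y) = s` at `y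
= -log s`. -/
theorem gammaProfile_natCast {k : ℕ} (hk : 0 < k) {s : ℝ} (hs : s ∈ Ioc (0 : ℝ) 1) :
    gammaProfile k s = averageProfile k s := by
  have hΓ : Real.Gamma k ≠ 0 := (Real.Gamma_pos_of_pos (by exact_mod_cast hk)).ne'
  rw [gammaProfile, upperGamma_natCast hk (neg_nonneg.2 (Real.log_nonpos hs.1.le hs.2)),
    mul_div_cancel_left₀ _ hΓ, neg_neg, Real.exp_log hs.1, averageProfile]

theorem gammaProfile_pos {n s : ℝ} (hn : 0 < n) (hs : s ∈ Ioo (0 : ℝ) 1) : 0 < gammaProfile n s := by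
  rw [gammaProfile, sub_pos, div_lt_one (Real.Gamma_pos_of_pos hn)]
  exact upperGamma_lt hn (neg_pos.2 (Real.log_neg hs.1 hs.2))

theorem gammaProfile_le_one {n s : ℝ} (hn : 0 < n) (hs : s ∈ Ioc (0 : ℝ) 1) :
    gammaProfile n s ≤ 1 :=
  sub_le_self _ (div_nonneg (upperGamma_nonneg (neg_nonneg.2 (Real.log_nonpos hs.1.le hs.2)))
    (Real.Gamma_pos_of_pos hn).le)

theorem antitoneOn_gammaProfile {n : ℝ} (hn : 0 < n) : AntitoneOn (gammaProfile n) (Ioc 0 1) := by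
  intro x hx y hy hxy
  refine sub_le_sub_left (div_le_div_of_nonneg_right ?_ (Real.Gamma_pos_of_pos hn).le) 1
  exact upperGamma_anti hn (neg_nonneg.2 (Real.log_nonpos hy.1.le hy.2))
    (neg_le_neg (Real.log_le_log hx.1 hxy))

/-! ### Jump laws -/

/-- A jump law: a probability measure with bounded support in `[0, ∞)` and moments `μ`. -/
structure IsJumpLaw (ν : Measure ℝ) (μ : ℕ → ℝ) : Prop where
  isProbabilityMeasure : IsProbabilityMeasure ν
  bounded : ∃ G, ∀ᵐ x ∂ν, x ∈ Icc 0 G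
  moment : ∀ m, 1 ≤ m → ∫ x, x ^ m ∂ν = μ m

/-- The exponent `∫ (e^(-ux) - 1) dν` of a compound Poisson law of unit intensity. -/
noncomputable def jumpExponent (ν : Measure ℝ) (u : ℝ) : ℝ := (∫ x, Real.exp (-u * x) ∂ν) - 1

theorem integrable_exp_neg_mul {ν : Measure ℝ} [IsFiniteMeasure ν] {G : ℝ}
    (hν : ∀ᵐ x ∂ν, x ∈ Icc 0 G) (u : ℝ) : Integrable (fun x => Real.exp (-u * x)) ν :=
  integrable_exp_mul_id hν (-u)

theorem IsJumpLaw.antitoneOn_jumpExponent {ν : Measure ℝ} {μ : ℕ → ℝ} (h : IsJumpLaw ν μ)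
    {lam : ℝ} (hlam : 0 ≤ lam) : AntitoneOn (fun u => lam * jumpExponent ν u) (Ici 0) := by
  have := h.isProbabilityMeasure
  obtain ⟨G, hG⟩ := h.bounded
  intro x hx y hy hxy
  refine mul_le_mul_of_nonneg_left (sub_le_sub_right ?_ 1) hlam
  refine integral_mono_ae (integrable_exp_neg_mul hG y) (integrable_exp_neg_mul hG x) ?_
  filter_upwards [hG] with z hz
  exact Real.exp_le_exp.2 (mul_le_mul_of_nonneg_right (neg_le_neg hxy) hz.1)

theorem isJumpLaw_dirac {a : ℝ} (ha : 0 ≤ a) : IsJumpLaw (Measure.dirac a) fun m => a ^ m where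
  isProbabilityMeasure := inferInstance
  bounded := ⟨a, (ae_dirac_iff measurableSet_Icc).2 ⟨ha, le_rfl⟩⟩
  moment m _ := by simp

theorem jumpExponent_dirac (a u : ℝ) : jumpExponent (Measure.dirac a) u = Real.exp (-u * a) - 1 := by
  simp [jumpExponent]

/-- The law of `g / b` under the uniform distribution on `(0, 1]`. -/
noncomputable def profileLaw (g : ℝ → ℝ) (b : ℝ) : Measure ℝ :=
  (volume.restrict (Ioc (0 : ℝ) 1)).map fun s => g s / b

theorem isProbabilityMeasure_uniform : IsProbabilityMeasure (volume.restrict (Ioc (0 : ℝ) 1)) :=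
  ⟨by simp⟩

theorem isJumpLaw_profileLaw {g : ℝ → ℝ} {b G : ℝ} (hb : 0 < b)
    (hg : AEMeasurable g (volume.restrict (Ioc (0 : ℝ) 1)))
    (hgG : ∀ s ∈ Ioo (0 : ℝ) 1, g s ∈ Icc 0 G) :
    IsJumpLaw (profileLaw g b) fun m => (∫ s in (0 : ℝ)..1, g s ^ m) / b ^ m where
  isProbabilityMeasure := by
    have := isProbabilityMeasure_uniform
    exact Measure.isProbabilityMeasure_map (hg.div_const b)
  bounded := by
    refine ⟨G / b, ?_⟩
    refine (ae_map_iff (hg.div_const b) measurableSet_Icc).2 ?_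
    rw [← restrict_Ioo_eq_restrict_Ioc]
    filter_upwards [ae_restrict_mem measurableSet_Ioo] with s hs
    obtain ⟨h1, h2⟩ := hgG s hs
    exact ⟨by positivity, by gcongr⟩
  moment m _ := by
    rw [profileLaw, integral_map (hg.div_const b) (by fun_prop),
      intervalIntegral.integral_of_le zero_le_one, ← integral_div]
    simp only [div_pow]

/-! ### Regulated clocks through iterated weighted integrals and compound Poisson transforms -/

theorem iterate_runningAverage {Ω : Type*} (X : ℝ≥0 → Ω → ℝ) (k : ℕ) (t : ℝ≥0) (ω : Ω) :
    runningAverage^[k] X t ω = (weightedIntegral fun r => (r : ℝ)⁻¹)^[k] (fun s => X s ω) t := by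
  induction k generalizing t with
  | zero => rfl
  | succ k ih =>
    simp only [Function.iterate_succ_apply', runningAverage, pathIntegral, weightedIntegral, ih]

theorem iterate_pathIntegral {Ω : Type*} (X : ℝ≥0 → Ω → ℝ) (k : ℕ) (t : ℝ≥0) (ω : Ω) :
    pathIntegral^[k] X t ω = (weightedIntegral fun _ => 1)^[k] (fun s => X s ω) t := by
  induction k generalizing t with
  | zero => rfl
  | succ k ih =>
    simp only [Function.iterate_succ_apply', pathIntegral, weightedIntegral, ih, one_mul]

section Clocks

variable {Ω : Type*} [MeasurableSpace Ω] {P : Measure Ω}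

/-- `Y` has the Laplace transform of a compound Poisson law with intensity `c` and with jump moments
`μ`. -/
def HasCompoundPoissonLaplace (P : Measure Ω) (Y : Ω → ℝ) (c : ℝ) (μ : ℕ → ℝ) : Prop :=
  ∃ ν, IsJumpLaw ν μ ∧ ∀ u : ℝ, 0 ≤ u →
    ∫ ω, Real.exp (-u * Y ω) ∂P = Real.exp (c * jumpExponent ν u)

theorem hasCompoundPoissonLaplace_of_profile {Y : Ω → ℝ} {g : ℝ → ℝ} {b G c : ℝ} (hb : 0 < b)
    (hg : AEMeasurable g (volume.restrict (Ioc (0 : ℝ) 1)))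
    (hgG : ∀ s ∈ Ioo (0 : ℝ) 1, g s ∈ Icc 0 G)
    (h : ∀ u : ℝ, 0 ≤ u → ∫ ω, Real.exp (-u * Y ω) ∂P =
      Real.exp (c * ∫ s in (0 : ℝ)..1, (Real.exp (-(u * g s / b)) - 1))) :
    HasCompoundPoissonLaplace P Y c fun m => (∫ s in (0 : ℝ)..1, g s ^ m) / b ^ m := by
  have hν := isJumpLaw_profileLaw hb hg hgG
  refine ⟨profileLaw g b, hν, fun u hu => ?_⟩
  rw [h u hu]
  have := isProbabilityMeasure_uniform
  have := hν.isProbabilityMeasure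
  obtain ⟨G', hG'⟩ := hν.bounded
  have hi := integrable_exp_neg_mul hG' u
  rw [profileLaw, integrable_map_measure (by fun_prop) (hg.div_const b)] at hi
  rw [jumpExponent, profileLaw, integral_map (hg.div_const b) (by fun_prop),
    intervalIntegral.integral_of_le zero_le_one]
  have h1 : ∀ s, Real.exp (-(u * g s / b)) = Real.exp (-u * (g s / b)) := fun s => by ring_nf
  simp only [h1]
  rw [integral_sub (by exact hi) (integrable_const 1)]
  simp

theorem HasCompoundPoissonLaplace.congr {Y : Ω → ℝ} {c : ℝ} {μ μ' : ℕ → ℝ}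
    (h : HasCompoundPoissonLaplace P Y c μ) (hμ : ∀ m, 1 ≤ m → μ m = μ' m) :
    HasCompoundPoissonLaplace P Y c μ' := by
  obtain ⟨ν, hν, h⟩ := h
  exact ⟨ν, ⟨hν.1, hν.2, fun m hm => (hν.3 m hm).trans (hμ m hm)⟩, h⟩

theorem HasCompoundPoissonLaplace.identDistrib {Y Y' : Ω → ℝ} {c : ℝ} {μ : ℕ → ℝ}
    (h : HasCompoundPoissonLaplace P Y c μ) (hY : IdentDistrib Y' Y P P) :
    HasCompoundPoissonLaplace P Y' c μ := by
  obtain ⟨ν, hν, h⟩ := h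
  refine ⟨ν, hν, fun u hu => ?_⟩
  rw [← h u hu]
  exact (hY.comp (u := fun x => Real.exp (-u * x)) (by fun_prop)).integral_eq

/-! ### The scaled Poisson process -/

theorem IsPoissonProcess.integral_exp {lam : ℝ} (hlam : 0 < lam) {X : ℝ≥0 → Ω → ℝ}
    (hX : IsPoissonProcess lam X P) (t : ℝ≥0) (b u : ℝ) :
    ∫ ω, Real.exp (-u * (X t ω / b)) ∂P = Real.exp (t * (lam * (Real.exp (-(u / b)) - 1))) := by
  set r := lam.toNNReal * t with hr
  have h1 : ∫ ω, Real.exp (-u * (X t ω / b)) ∂P =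
      ∫ x, Real.exp (-u * (x / b)) ∂(P.map (X t)) := by
    rw [integral_map (hX.subordinator.aemeasurable t) (by fun_prop)]
  rw [h1, hX.law t, integral_map (by fun_prop) (by fun_prop), integral_poissonMeasure]
  have h2 : ∀ k : ℕ, (Real.exp (-r) * r ^ k / k.factorial) • Real.exp (-u * ((k : ℝ) / b)) =
      Real.exp (-r) * ((r * Real.exp (-(u / b))) ^ k / k.factorial) := fun k => by
    rw [mul_pow, ← Real.exp_nat_mul, smul_eq_mul]
    have : -u * ((k : ℝ) / b) = k * -(u / b) := by ring
    rw [this]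
    ring
  rw [tsum_congr h2, tsum_mul_left, ← congrFun NormedSpace.exp_eq_tsum_div, ← Real.exp_eq_exp_ℝ, ← Real.exp_add]
  congr 1
  rw [hr]
  push_cast
  rw [Real.coe_toNNReal lam hlam.le]
  ring

theorem IsPoissonProcess.scaled {lam b : ℝ} (hb : 0 < b) {X : ℝ≥0 → Ω → ℝ}
    (hX : IsPoissonProcess lam X P) : IsSubordinator (fun t ω => X t ω / b) P where
  aemeasurable t := (hX.subordinator.aemeasurable t).div_const b
  zero := by
    filter_upwards [hX.subordinator.zero] with ω h
    rw [h, zero_div]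
  indep := fun k t ht => by
    have := (hX.subordinator.indep k t ht).comp (fun _ x => x / b)
      fun _ => measurable_id.div_const b
    convert! this using 2 with i
    funext ω
    simp [sub_div]
  stationary s t := by
    have := (hX.subordinator.stationary s t).div_const b
    simpa only [sub_div] using this
  mono := by
    filter_upwards [hX.subordinator.mono] with ω h s t hst
    exact div_le_div_of_nonneg_right (h hst) hb.le
  rightCont := by
    filter_upwards [hX.subordinator.rightCont] with ω h t
    exact (h t).div_const b

theorem IsPoissonProcess.logLaplace_scaled {lam : ℝ} (hlam : 0 < lam) {X : ℝ≥0 → Ω → ℝ}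
    (hX : IsPoissonProcess lam X P) (b u : ℝ) :
    logLaplace P (fun ω => X 1 ω / b) u = lam * (Real.exp (-(u / b)) - 1) := by
  rw [logLaplace, hX.integral_exp hlam, Real.log_exp]
  simp

theorem antitone_poissonExponent {lam b : ℝ} (hlam : 0 < lam) (hb : 0 < b) :
    Antitone fun u : ℝ => lam * (Real.exp (-(u / b)) - 1) := fun x y hxy => by
  refine mul_le_mul_of_nonneg_left (sub_le_sub_right (Real.exp_le_exp.2 ?_) 1) hlam.le
  gcongr

theorem IsPoissonProcess.hasCompoundPoissonLaplace {lam b : ℝ} (hlam : 0 < lam) (hb : 0 < b)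
    {X : ℝ≥0 → Ω → ℝ} (hX : IsPoissonProcess lam X P) (t : ℝ≥0) :
    HasCompoundPoissonLaplace P (fun ω => X t ω / b) (t * lam) fun m => 1 / b ^ m := by
  have := isJumpLaw_dirac (a := 1 / b) (by positivity)
  simp only [one_div_pow] at this
  refine ⟨_, this, fun u _ => ?_⟩
  rw [hX.integral_exp hlam, jumpExponent_dirac]
  ring_nf

/-! ### Type I -/

/-- At the endpoint `a = t` both sides vanish once `k > 0`. For `k = 0` they would differ: the step
is `0` there and the profile is `1`. -/
theorem iterate_average_unitStep_of_pos {k : ℕ} (hk : 0 < k) {a t : ℝ≥0} (ht : 0 < t) (hat : a ≤ t) :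
    (weightedIntegral fun r => (r : ℝ)⁻¹)^[k] (unitStep a) t = averageProfile k (a / t) := by
  rcases hat.lt_or_eq with h | rfl
  · exact (iterate_average_unitStep k a t).2 h
  · have : (a : ℝ) ≠ 0 := by exact_mod_cast ht.ne'
    obtain ⟨k, rfl⟩ := Nat.exists_eq_succ_of_ne_zero hk.ne'
    rw [(iterate_average_unitStep _ a a).1 le_rfl, div_self this, averageProfile,
      Finset.sum_range_succ']
    simp

theorem iterate_integral_unitStep_of_pos {k : ℕ} (hk : 0 < k) {a t : ℝ≥0} (hat : a ≤ t) :
    (weightedIntegral fun _ => 1)^[k] (unitStep a) t = ((t : ℝ) - a) ^ k / k.factorial := by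
  rcases hat.lt_or_eq with h | rfl
  · exact (iterate_integral_unitStep k a t).2 h
  · rw [(iterate_integral_unitStep _ a a).1 le_rfl]
    simp [hk.ne']

theorem aemeasurable_gammaProfile {n : ℝ} (hn : 0 < n) :
    AEMeasurable (gammaProfile n) (volume.restrict (Ioc (0 : ℝ) 1)) :=
  aemeasurable_restrict_of_antitoneOn measurableSet_Ioc (antitoneOn_gammaProfile hn)

theorem hasCompoundPoissonLaplace_gammaProfile {Y : Ω → ℝ} {n b c lam : ℝ} (hn : 0 < n) (hb : 0 < b)
    (h : ∀ u : ℝ, 0 ≤ u → ∫ ω, Real.exp (-u * Y ω) ∂P = Real.exp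
      (c * ∫ s in (0 : ℝ)..1, lam * (Real.exp (-(u * gammaProfile n s / b)) - 1))) :
    HasCompoundPoissonLaplace P Y (c * lam) fun m => rho .I m n / b ^ m := by
  have := hasCompoundPoissonLaplace_of_profile (P := P) (Y := Y) (c := c * lam) hb
    (aemeasurable_gammaProfile hn)
    (fun s hs => ⟨(gammaProfile_pos hn hs).le, gammaProfile_le_one hn (Ioo_subset_Ioc_self hs)⟩)
    (fun u hu => by rw [h u hu, intervalIntegral.integral_const_mul, mul_assoc])
  refine this.congr fun m _ => ?_
  simp only [rho, C, if_neg hn.ne', gammaProfile]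

theorem hasCompoundPoissonLaplace_typeI_nat [IsProbabilityMeasure P] {X : ℝ≥0 → Ω → ℝ} {Y : Ω → ℝ}
    {lam b : ℝ} (hlam : 0 < lam) (hb : 0 < b) (hX : IsPoissonProcess lam X P) {k : ℕ} (hk : 0 < k)
    {t : ℝ≥0} (ht : 0 < t)
    (hY : IdentDistrib Y (runningAverage^[k] (fun t ω => X t ω / b) t) P P) :
    HasCompoundPoissonLaplace P Y (t * lam) fun m => rho .I m k / b ^ m := by
  refine HasCompoundPoissonLaplace.identDistrib ?_ hY
  refine hasCompoundPoissonLaplace_gammaProfile (by exact_mod_cast hk) hb fun u hu => ?_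
  simp only [iterate_runningAverage]
  rw [(hX.scaled hb).integral_exp_iterate ((antitone_poissonExponent hlam hb).antitoneOn _)
    (fun s u _ => hX.integral_exp hlam s b u) isAveragingWeight_inv k ht
    (fun a ha => iterate_average_unitStep_of_pos hk ht ha) hu]
  congr 2
  refine intervalIntegral.integral_congr_ae (.of_forall fun s hs => ?_)
  rw [uIoc_of_le zero_le_one] at hs
  rw [gammaProfile_natCast hk hs]

/-! ### Type III -/

theorem hasCompoundPoissonLaplace_powProfile {Y : Ω → ℝ} {n b c lam : ℝ} (hn : 0 < n) (hb : 0 < b)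
    (h : ∀ u : ℝ, 0 ≤ u → ∫ ω, Real.exp (-u * Y ω) ∂P = Real.exp
      (c * ∫ s in (0 : ℝ)..1, lam * (Real.exp (-(s ^ n * u / Real.Gamma (n + 1) / b)) - 1))) :
    HasCompoundPoissonLaplace P Y (c * lam) fun m => rho .III m n / b ^ m := by
  have hΓ : 0 < Real.Gamma (n + 1) := Real.Gamma_pos_of_pos (by positivity)
  have := hasCompoundPoissonLaplace_of_profile (P := P) (Y := Y) (c := c * lam)
    (g := fun s => s ^ n / Real.Gamma (n + 1)) (G := 1 / Real.Gamma (n + 1)) hb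
    (by fun_prop)
    (fun s hs => by
      have h0 := hs.1
      have h1 : s ^ n ≤ 1 := Real.rpow_le_one hs.1.le hs.2.le hn.le
      exact ⟨by positivity, by gcongr⟩)
    (fun u hu => by
      rw [h u hu, intervalIntegral.integral_const_mul, mul_assoc]
      congr 4 with s
      ring_nf)
  refine this.congr fun m _ => ?_
  have h1 : ∫ s in (0 : ℝ)..1, (s ^ n / Real.Gamma (n + 1)) ^ m =
      (∫ s in (0 : ℝ)..1, s ^ ((m : ℝ) * n)) / Real.Gamma (n + 1) ^ m := by
    rw [← intervalIntegral.integral_div]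
    refine intervalIntegral.integral_congr fun s hs => ?_
    rw [uIcc_of_le zero_le_one] at hs
    rw [div_pow, mul_comm (m : ℝ), Real.rpow_mul hs.1, Real.rpow_natCast]
  have h2 : (-1 : ℝ) < m * n := by
    have : 0 ≤ (m : ℝ) * n := by positivity
    linarith
  have h3 : (m : ℝ) * n + 1 ≠ 0 := by linarith
  rw [h1, integral_rpow (.inl h2)]
  simp only [rho, Real.one_rpow, Real.zero_rpow h3, sub_zero]
  simp only [div_div, mul_assoc]

theorem hasCompoundPoissonLaplace_typeIII_nat [IsProbabilityMeasure P] {X : ℝ≥0 → Ω → ℝ}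
    {Y : Ω → ℝ} {lam b : ℝ} (hlam : 0 < lam) (hb : 0 < b) (hX : IsPoissonProcess lam X P) {k : ℕ}
    (hk : 0 < k) {t : ℝ≥0} (ht : 0 < t)
    (hY : IdentDistrib Y
      (fun ω => ((t : ℝ) ^ k)⁻¹ * (pathIntegral^[k] (fun t ω => X t ω / b)) t ω) P P) :
    HasCompoundPoissonLaplace P Y (t * lam) fun m => rho .III m k / b ^ m := by
  have ht' : (0 : ℝ) < t := by exact_mod_cast ht
  refine HasCompoundPoissonLaplace.identDistrib ?_ hY
  refine hasCompoundPoissonLaplace_powProfile (by exact_mod_cast hk) hb fun u hu => ?_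
  simp only [iterate_pathIntegral]
  have hg : ∀ a : ℝ≥0, a ≤ t → (weightedIntegral fun _ => 1)^[k] (unitStep a) t =
      (fun x : ℝ => (t : ℝ) ^ k * (1 - x) ^ k / k.factorial) (a / t) := fun a ha => by
    rw [iterate_integral_unitStep_of_pos hk ha]
    simp only []
    rw [← mul_pow, mul_sub, mul_one, mul_div_cancel₀ _ ht'.ne']
  -- The normalisation `t^(-k)` is absorbed into the Laplace variable, where it cancels the factor
  -- `t^k` of the profile.
  have hu' : 0 ≤ u * ((t : ℝ) ^ k)⁻¹ := by positivity
  have := (hX.scaled hb).integral_exp_iterate ((antitone_poissonExponent hlam hb).antitoneOn _)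
    (fun s u _ => hX.integral_exp hlam s b u) isAveragingWeight_one k ht
    (g := fun x : ℝ => (t : ℝ) ^ k * (1 - x) ^ k / k.factorial) hg hu'
  have hΓ : Real.Gamma ((k : ℝ) + 1) = k.factorial := Real.Gamma_nat_eq_factorial k
  -- The reflection `s ↦ 1 - s` turns the profile `(1 - s)^k / k!` into that of the real-degree
  -- formula.
  have h1 := intervalIntegral.integral_comp_sub_left (a := 0) (b := 1) (fun s : ℝ =>
    lam * (Real.exp (-(s ^ (k : ℝ) * u / Real.Gamma (k + 1) / b)) - 1)) 1
  rw [sub_self, sub_zero] at h1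
  rw [← h1]
  have h2 : ∀ A : ℝ, -u * (((t : ℝ) ^ k)⁻¹ * A) = -(u * ((t : ℝ) ^ k)⁻¹) * A := fun A => by ring
  simp only [h2]
  rw [this]
  congr 2
  refine intervalIntegral.integral_congr fun s _ => ?_
  simp only [Real.rpow_natCast, hΓ]
  congr 4
  field_simp

end Clocks

/-! ### The gamma law behind type II -/

theorem measurable_gammaPDF (a r : ℝ) : Measurable (gammaPDF a r) :=
  (measurable_gammaPDFReal a r).ennreal_ofReal

theorem integral_gammaMeasure_one {n : ℝ} (hn : 0 < n) (h : ℝ → ℝ) :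
    ∫ x, h x ∂(gammaMeasure n 1) =
      1 / Real.Gamma n * ∫ x in Ioi (0 : ℝ), x ^ (n - 1) * Real.exp (-x) * h x := by
  rw [gammaMeasure, integral_withDensity_eq_integral_toReal_smul
    (measurable_gammaPDF n 1) (.of_forall fun x => ENNReal.ofReal_lt_top),
    ← integral_Ici_eq_integral_Ioi, ← integral_const_mul, ← integral_indicator measurableSet_Ici]
  congr 1 with x
  rw [gammaPDF, ENNReal.toReal_ofReal (gammaPDFReal_nonneg hn one_pos x)]
  by_cases hx : 0 ≤ x
  · rw [indicator_of_mem (mem_Ici.2 hx), gammaPDFReal, if_pos hx]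
    simp
    ring
  · rw [indicator_of_notMem (by simpa using hx), gammaPDFReal, if_neg hx, zero_smul]

/-- The substitution `v = e^(-x)` converts the logarithmic weight of type II into an unnormalised
gamma density. -/
theorem integral_comp_exp_neg {n : ℝ} (f : ℝ → ℝ) :
    ∫ v in (0 : ℝ)..1, (-Real.log v) ^ (n - 1) * f v =
      ∫ x in Ioi (0 : ℝ), x ^ (n - 1) * Real.exp (-x) * f (Real.exp (-x)) := by
  have himg : (fun x : ℝ => Real.exp (-x)) '' Ioi 0 = Ioo 0 1 := by
    ext v
    constructor
    · rintro ⟨x, hx, rfl⟩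
      exact ⟨Real.exp_pos _, Real.exp_lt_one_iff.2 (neg_lt_zero.2 hx)⟩
    · intro hv
      exact ⟨-Real.log v, neg_pos.2 (Real.log_neg hv.1 hv.2), by simp [Real.exp_log hv.1]⟩
  rw [intervalIntegral.integral_of_le zero_le_one, integral_Ioc_eq_integral_Ioo, ← himg,
    integral_image_eq_integral_abs_deriv_smul measurableSet_Ioi
      (fun x _ => (hasDerivAt_neg x).exp.hasDerivWithinAt)
      (fun x _ y _ hxy => neg_injective (Real.exp_injective hxy))]
  congr 1 with x
  rw [Real.log_exp, neg_neg, mul_neg_one, abs_neg, abs_of_pos (Real.exp_pos _), smul_eq_mul]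
  ring

section Clocks

variable {Ω : Type*} [MeasurableSpace Ω] {P : Measure Ω}

/-! ### Type II -/

/-- For a gamma variable `T` of shape `n` and rate `1`, `E e^(-mT) = (m + 1)^(-n)`. For integer `n`,
`e^(-T)` is distributed as a product of `n` independent uniforms, in agreement with repeated
averaging. -/
theorem isJumpLaw_map_gammaMeasure {n b : ℝ} (hn : 0 < n) (hb : 0 < b) :
    IsJumpLaw ((gammaMeasure n 1).map fun x => Real.exp (-x) / b)
      fun m => rho .II m n / b ^ m where
  isProbabilityMeasure := by
    have := isProbabilityMeasure_gammaMeasure hn one_pos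
    exact Measure.isProbabilityMeasure_map (by fun_prop)
  bounded := by
    refine ⟨1 / b, (ae_map_iff (by fun_prop) measurableSet_Icc).2 ?_⟩
    have h0 : ∀ᵐ x ∂(gammaMeasure n 1), 0 ≤ x := by
      rw [gammaMeasure, ae_withDensity_iff (measurable_gammaPDF n 1)]
      refine .of_forall fun x hx => ?_
      by_contra h
      exact hx (gammaPDF_of_neg (not_le.1 h))
    filter_upwards [h0] with x hx
    exact ⟨by positivity, by gcongr; exact Real.exp_le_one_iff.2 (neg_nonpos.2 hx)⟩
  moment m _ := by
    have hΓ := (Real.Gamma_pos_of_pos hn).ne'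
    rw [integral_map (by fun_prop) (by fun_prop), integral_gammaMeasure_one hn]
    have h1 : ∀ x : ℝ, x ^ (n - 1) * Real.exp (-x) * (Real.exp (-x) / b) ^ m =
        x ^ (n - 1) * Real.exp (-(((m : ℝ) + 1) * x)) / b ^ m := fun x => by
      have : Real.exp (-(((m : ℝ) + 1) * x)) = Real.exp (-x) ^ m * Real.exp (-x) := by
        rw [← Real.exp_nat_mul, ← Real.exp_add]; ring_nf
      rw [this, div_pow]
      ring
    simp only [h1]
    rw [integral_div, Real.integral_rpow_mul_exp_neg_mul_Ioi hn (by positivity), rho,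
      Real.div_rpow zero_le_one (by positivity), Real.one_rpow]
    field_simp

theorem hasCompoundPoissonLaplace_typeII_real {X : ℝ≥0 → Ω → ℝ} {Y : Ω → ℝ}
    {lam b n c : ℝ} (hlam : 0 < lam) (hb : 0 < b) (hX : IsPoissonProcess lam X P) (hn : 0 < n)
    (hY : ∀ u : ℝ, 0 ≤ u → ∫ ω, Real.exp (-u * Y ω) ∂P =
      Real.exp (c * regulatedLogLaplace P (fun t ω => X t ω / b) n .II u)) :
    HasCompoundPoissonLaplace P Y (c * lam) fun m => rho .II m n / b ^ m := by
  have hν := isJumpLaw_map_gammaMeasure hn hb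
  have := hν.isProbabilityMeasure
  have := isProbabilityMeasure_gammaMeasure hn one_pos
  refine ⟨_, hν, fun u hu => ?_⟩
  obtain ⟨G, hG⟩ := hν.bounded
  have hi := integrable_exp_neg_mul hG u
  rw [integrable_map_measure (by fun_prop) (by fun_prop)] at hi
  have h1 : jumpExponent ((gammaMeasure n 1).map fun x => Real.exp (-x) / b) u =
      ∫ x, (Real.exp (-u * (Real.exp (-x) / b)) - 1) ∂(gammaMeasure n 1) := by
    rw [jumpExponent, integral_map (by fun_prop) (by fun_prop),
      integral_sub (by exact hi) (integrable_const 1)]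
    simp
  rw [hY u hu, h1, integral_gammaMeasure_one hn, regulatedLogLaplace]
  simp only [hX.logLaplace_scaled hlam]
  rw [integral_comp_exp_neg, mul_assoc c, mul_left_comm lam, ← integral_const_mul lam]
  congr 4 with x
  ring_nf

/-- The law of the product of a jump with an independent uniform variable. -/
noncomputable def uniformProductLaw (ν : Measure ℝ) : Measure ℝ :=
  ((volume.restrict (Ioc (0 : ℝ) 1)).prod ν).map fun p => p.1 * p.2

/-- By independence the moments multiply, and a uniform variable has `m`-th moment `1 / (m + 1)`. -/
theorem IsJumpLaw.uniformProductLaw {ν : Measure ℝ} {μ : ℕ → ℝ} (h : IsJumpLaw ν μ) :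
    IsJumpLaw (uniformProductLaw ν) fun m => 1 / ((m : ℝ) + 1) * μ m where
  isProbabilityMeasure := by
    have := h.isProbabilityMeasure
    have := isProbabilityMeasure_uniform
    exact Measure.isProbabilityMeasure_map (by fun_prop)
  bounded := by
    have := h.isProbabilityMeasure
    obtain ⟨G, hG⟩ := h.bounded
    refine ⟨G, (ae_map_iff (by fun_prop) measurableSet_Icc).2 ?_⟩
    have h1 : ∀ᵐ p ∂((volume.restrict (Ioc (0 : ℝ) 1)).prod ν), p.1 ∈ Ioc (0 : ℝ) 1 :=
      Measure.quasiMeasurePreserving_fst.ae (ae_restrict_mem measurableSet_Ioc)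
    have h2 : ∀ᵐ p ∂((volume.restrict (Ioc (0 : ℝ) 1)).prod ν), p.2 ∈ Icc (0 : ℝ) G :=
      Measure.quasiMeasurePreserving_snd.ae hG
    filter_upwards [h1, h2] with p hp hq
    exact ⟨mul_nonneg hp.1.le hq.1, (mul_le_of_le_one_left hq.1 hp.2).trans hq.2⟩
  moment m hm := by
    have := h.isProbabilityMeasure
    rw [ClockRegulation.uniformProductLaw, integral_map (by fun_prop) (by fun_prop)]
    simp only [mul_pow]
    rw [integral_prod_mul (fun s : ℝ => s ^ m) (fun x : ℝ => x ^ m), h.moment m hm,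
      ← intervalIntegral.integral_of_le zero_le_one, integral_pow]
    simp

theorem IsJumpLaw.jumpExponent_uniformProductLaw {ν : Measure ℝ} {μ : ℕ → ℝ} (h : IsJumpLaw ν μ)
    (u : ℝ) : jumpExponent (ClockRegulation.uniformProductLaw ν) u =
      ∫ s in (0 : ℝ)..1, jumpExponent ν (u * s) := by
  have := h.isProbabilityMeasure
  have := isProbabilityMeasure_uniform
  have := h.uniformProductLaw.isProbabilityMeasure
  obtain ⟨G, hG⟩ := h.uniformProductLaw.bounded
  have hi := integrable_exp_neg_mul hG u
  rw [ClockRegulation.uniformProductLaw, integrable_map_measure (by fun_prop) (by fun_prop)] at hi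
  rw [jumpExponent, ClockRegulation.uniformProductLaw, integral_map (by fun_prop) (by fun_prop),
    integral_prod _ (by exact hi), intervalIntegral.integral_of_le zero_le_one]
  simp only [jumpExponent]
  rw [integral_sub]
  · simp [mul_assoc]
  · simpa [mul_assoc, Function.comp_def] using hi.integral_prod_left
  · exact integrable_const 1

/-- A jump at time `x t` enters the average with weight `1 - x`. Since `1 - x` is uniform when `x`
is, averaging multiplies each jump by an independent uniform variable. -/
theorem hasCompoundPoissonLaplace_runningAverage [IsProbabilityMeasure P] {Z : ℝ≥0 → Ω → ℝ}
    (hZ : IsSubordinator Z P) {ν : Measure ℝ} {μ : ℕ → ℝ} (hν : IsJumpLaw ν μ) {lam : ℝ}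
    (hlam : 0 ≤ lam)
    (h : ∀ (t : ℝ≥0) (u : ℝ), 0 ≤ u →
      ∫ ω, Real.exp (-u * Z t ω) ∂P = Real.exp (t * (lam * jumpExponent ν u)))
    (t : ℝ≥0) (u : ℝ) (hu : 0 ≤ u) :
    ∫ ω, Real.exp (-u * runningAverage Z t ω) ∂P =
      Real.exp (t * (lam * jumpExponent (uniformProductLaw ν) u)) := by
  rcases eq_or_ne t 0 with rfl | ht
  · simp [runningAverage]
  have := hZ.integral_exp_iterate (hν.antitoneOn_jumpExponent hlam) h isAveragingWeight_inv 1
    (pos_iff_ne_zero.2 ht) (fun a ha => iterate_average_unitStep_of_pos one_pos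
      (pos_iff_ne_zero.2 ht) ha) hu
  simp only [← iterate_runningAverage, Function.iterate_one] at this
  rw [this, hν.jumpExponent_uniformProductLaw, intervalIntegral.integral_const_mul]
  have h1 := intervalIntegral.integral_comp_sub_left (a := 0) (b := 1) (fun s : ℝ =>
    jumpExponent ν (u * s)) 1
  rw [sub_self, sub_zero] at h1
  rw [← h1]
  simp [averageProfile]

theorem hasCompoundPoissonLaplace_typeII_nat [IsProbabilityMeasure P] {X : ℝ≥0 → Ω → ℝ}
    {Z : ℕ → ℝ≥0 → Ω → ℝ} {lam b : ℝ} (hlam : 0 < lam) (hb : 0 < b)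
    (hX : IsPoissonProcess lam X P) {k : ℕ} (h0 : Z 0 = fun t ω => X t ω / b)
    (hZ : ∀ j < k, IsSubordinator (Z (j + 1)) P ∧
      ∀ t, IdentDistrib (Z (j + 1) t) (runningAverage (Z j) t) P P) (t : ℝ≥0) :
    HasCompoundPoissonLaplace P (Z k t) (t * lam) fun m => rho .II m k / b ^ m := by
  have key : ∀ j ≤ k, IsSubordinator (Z j) P ∧ ∃ ν, IsJumpLaw ν (fun m => rho .II m j / b ^ m) ∧
      ∀ (t : ℝ≥0) (u : ℝ), 0 ≤ u →
        ∫ ω, Real.exp (-u * Z j t ω) ∂P = Real.exp (t * (lam * jumpExponent ν u)) := by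
    intro j
    induction j with
    | zero =>
      intro _
      refine ⟨h0 ▸ hX.scaled hb, Measure.dirac (1 / b), ?_, fun t u _ => ?_⟩
      · simpa [rho] using isJumpLaw_dirac (a := 1 / b) (by positivity)
      · rw [h0, hX.integral_exp hlam, jumpExponent_dirac]
        ring_nf
    | succ j ih =>
      intro hj
      obtain ⟨hsub, ν, hν, h⟩ := ih (by omega)
      obtain ⟨hsub', hid⟩ := hZ j (by omega)
      refine ⟨hsub', uniformProductLaw ν, ?_, fun t u hu => ?_⟩
      · convert! hν.uniformProductLaw using 2 with m
        have : (0 : ℝ) < (m : ℝ) + 1 := by positivity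
        simp only [rho, Real.rpow_natCast, pow_succ]
        field_simp
      · rw [← hasCompoundPoissonLaplace_runningAverage hsub hν hlam.le h t u hu]
        exact ((hid t).comp (u := fun x => Real.exp (-u * x)) (by fun_prop)).integral_eq
  obtain ⟨-, ν, hν, h⟩ := key k le_rfl
  exact ⟨ν, hν, fun u hu => by rw [h t u hu, mul_assoc]⟩

/-! ### Regulated clocks -/

theorem rho_zero (ty : RegType) (m : ℕ) : rho ty m 0 = 1 := by
  cases ty <;> simp [rho, C]

/-- The law of a regulated Poisson clock. -/
theorem IsRegulatedClock.hasCompoundPoissonLaplace [IsProbabilityMeasure P] {ty : RegType} {n : ℝ}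
    {X Y : ℝ≥0 → Ω → ℝ} {lam b : ℝ} (hlam : 0 < lam) (hb : 0 < b)
    (hX : IsPoissonProcess lam X P) (hY : IsRegulatedClock P ty n (fun t ω => X t ω / b) Y)
    {t : ℝ≥0} (ht : 0 < t) :
    HasCompoundPoissonLaplace P (Y t) (t * lam) fun m => rho ty m n / b ^ m := by
  obtain ⟨-, ⟨k, rfl, hk⟩ | ⟨hn, h⟩⟩ := hY
  · rcases Nat.eq_zero_or_pos k with rfl | hk0
    · have hid : IdentDistrib (Y t) (fun ω => X t ω / b) P P := by
        cases ty with
        | I => exact hk t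
        | II =>
          obtain ⟨Z, hZ0, -, hZ⟩ := hk
          have := hZ t
          rwa [hZ0] at this
        | III => simpa using hk t
      refine ((hX.hasCompoundPoissonLaplace hlam hb t).identDistrib hid).congr fun m _ => ?_
      rw [Nat.cast_zero, rho_zero]
    · cases ty with
      | I => exact hasCompoundPoissonLaplace_typeI_nat hlam hb hX hk0 ht (hk t)
      | II =>
        obtain ⟨Z, hZ0, hZ, hYZ⟩ := hk
        exact (hasCompoundPoissonLaplace_typeII_nat hlam hb hX hZ0 hZ t).identDistrib (hYZ t)
      | III => exact hasCompoundPoissonLaplace_typeIII_nat hlam hb hX hk0 ht (hk t)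
  · cases ty with
    | I =>
      refine hasCompoundPoissonLaplace_gammaProfile hn hb fun u hu => ?_
      rw [h t u hu, regulatedLogLaplace]
      simp only [hX.logLaplace_scaled hlam, gammaProfile, mul_comm u]
    | II => exact hasCompoundPoissonLaplace_typeII_real hlam hb hX hn (h t)
    | III =>
      refine hasCompoundPoissonLaplace_powProfile hn hb fun u hu => ?_
      rw [h t u hu, regulatedLogLaplace]
      simp only [hX.logLaplace_scaled hlam]

/-- Strict positivity at `m = 3, 4` fixes the signs of the third and fourth cumulants and permits
division. For type I it rests on the profile being positive inside the unit interval. -/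
theorem rho_pos (ty : RegType) (m : ℕ) {n : ℝ} (hn : 0 ≤ n) : 0 < rho ty m n := by
  rcases hn.eq_or_lt with rfl | hn
  · rw [rho_zero]; exact one_pos
  have hΓ : 0 < Real.Gamma (n + 1) := Real.Gamma_pos_of_pos (by positivity)
  cases ty with
  | I =>
    simp only [rho, C, if_neg hn.ne']
    refine intervalIntegral.intervalIntegral_pos_of_pos_on ?_
      (fun s hs => pow_pos (gammaProfile_pos hn hs) m) one_pos
    rw [intervalIntegrable_iff_integrableOn_Ioo_of_le zero_le_one]
    refine Integrable.of_mem_Icc 0 1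
      (((aemeasurable_gammaProfile hn).mono_set Ioo_subset_Ioc_self).pow_const m) ?_
    filter_upwards [ae_restrict_mem measurableSet_Ioo] with s hs
    have h0 := (gammaProfile_pos hn hs).le
    exact ⟨pow_nonneg h0 m, pow_le_one₀ h0 (gammaProfile_le_one hn (Ioo_subset_Ioc_self hs))⟩
  | II => simp only [rho]; positivity
  | III => simp only [rho]; positivity

end Clocks

/-! ### Cumulants and moment conditions -/

/-- The cumulants of the jump-diffusion with downside jumps. -/
theorem IsJumpDiffusion.cumulants {Ω : Type*} [MeasurableSpace Ω] {P : Measure Ω}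
    [IsProbabilityMeasure P] {ty : RegType} {n : ℝ} {p : Params} {L : ℝ≥0 → Ω → ℝ}
    (hp : p.Admissible) (hL : IsJumpDiffusion P ty n 0 1 p L) {Δ : ℝ≥0} (hΔ : 0 < Δ) :
    0 ∈ interior (integrableExpSet (L Δ) P) ∧ ∀ m, 1 ≤ m → cumulant P (L Δ) m =
      p.mu * Δ * (if m = 1 then 1 else 0) + Δ * p.lam * ((-1) ^ m * (rho ty m n / p.b ^ m)) +
        p.sigma ^ 2 * Δ / 2 * (if m = 2 then 2 else 0) := by
  obtain ⟨hlam, hb, -⟩ := hp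
  obtain ⟨X, Y, Y', W, hX, hY, hYY', hW, hind, hLt⟩ := hL
  have hid : IdentDistrib (Y' Δ) (Y Δ) P P :=
    hYY'.comp (u := fun f : ℝ≥0 → ℝ => f Δ) (measurable_pi_apply Δ)
  obtain ⟨ν, hν, h⟩ := hY.hasCompoundPoissonLaplace hlam hb hX hΔ
  have := hν.isProbabilityMeasure
  obtain ⟨G, hG⟩ := hν.bounded
  have hY' : ∀ u : ℝ, Integrable (fun ω => Real.exp (u * Y' Δ ω)) P ∧
      mgf (Y' Δ) P u = Real.exp (Δ * p.lam * (mgf id ν u - 1)) := by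
    refine mgf_eq_of_laplace_eq hid.aemeasurable_fst
      (hid.symm.ae_snd measurableSet_Ici (hY.1.nonneg Δ)) hG fun u hu => ?_
    rw [← jumpExponent, ← h u hu]
    exact (hid.comp (u := fun x => Real.exp (-u * x)) (by fun_prop)).integral_eq
  -- Only the downward clock and the Brownian motion, entries `1` and `2` of the family, matter: `Y`
  -- has coefficient `κ₁ = 0`.
  have hYW : IndepFun (Y' Δ) (W Δ) P :=
    (hind.indepFun (i := 1) (j := 2) (by decide)).comp (φ := fun f : ℝ≥0 → ℝ => f Δ)
      (ψ := fun f : ℝ≥0 → ℝ => f Δ) (measurable_pi_apply Δ) (measurable_pi_apply Δ)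
  have hLΔ : L Δ =ᵐ[P] fun ω => p.mu * Δ - Y' Δ ω + p.sigma * W Δ ω := by
    filter_upwards [hLt Δ] with ω h
    rw [h]
    ring
  have hcgf := cgf_jumpDiffusion hY' (hW.toIsPreBrownianReal.hasLaw_eval Δ) hYW hLΔ
  refine ⟨?_, fun m hm => ?_⟩
  · have huniv : integrableExpSet (L Δ) P = univ := eq_univ_of_forall fun u => (hcgf u).1
    simp [huniv]
  · rw [cumulant, funext fun u => (hcgf u).2, iteratedDeriv_jumpDiffusion_cgf hG, hν.moment m hm,
      if_neg (Nat.one_le_iff_ne_zero.1 hm), sub_zero]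

/-- Here `q` and `w` stand for `V^(3/2)` and `V^(1/2)`. The system is triangular: the ratio `-(b r₃
/ r₄)` involves `b` alone, the third cumulant then gives `lam`, the second `σ ^ 2` and the first
`mu`. -/
theorem moment_conditions_iff {r₁ r₂ r₃ r₄ Δ lam b mu σ M V q w SK EK : ℝ} (h₃ : 0 < r₃)
    (h₄ : 0 < r₄) (hΔ : 0 < Δ) (hlam : 0 < lam) (hb : 0 < b) (hq : 0 < q) (hw : 0 < w) :
    (mu * Δ - Δ * lam * (r₁ / b) = M ∧ Δ * lam * (r₂ / b ^ 2) + σ ^ 2 * Δ = V ∧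
      -(Δ * lam * (r₃ / b ^ 3)) = SK * q ∧
      -(Δ * lam * (r₃ / b ^ 3)) / (Δ * lam * (r₄ / b ^ 4)) = SK / (EK * w)) ↔
    (SK < 0 ∧ 0 < EK ∧ b = |SK| / (EK * w) * (r₄ / r₃) ∧ lam = |SK| * q * b ^ 3 / (Δ * r₃) ∧
      σ ^ 2 = V / Δ - r₂ * (lam / b ^ 2) ∧ mu = M / Δ + r₁ * (lam / b)) := by
  have hratio : -(Δ * lam * (r₃ / b ^ 3)) / (Δ * lam * (r₄ / b ^ 4)) = -(b * r₃ / r₄) := by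
    field_simp
  rw [hratio]
  have hpos : 0 < Δ * lam * (r₃ / b ^ 3) := by positivity
  constructor
  · rintro ⟨e1, e2, e3, e4⟩
    have hSK : SK < 0 := by
      by_contra h
      have := mul_nonneg (not_lt.1 h) hq.le
      linarith
    have hEK : 0 < EK := by
      -- The case `EK = 0` is covered too: the quotient is then `0` by convention, while the
      -- cumulant ratio is strictly negative.
      by_contra h
      have h1 : 0 ≤ SK / (EK * w) :=
        div_nonneg_of_nonpos hSK.le (mul_nonpos_of_nonpos_of_nonneg (not_lt.1 h) hw.le)
      have h2 : 0 < b * r₃ / r₄ := by positivity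
      linarith
    rw [abs_of_neg hSK]
    refine ⟨hSK, hEK, ?_, ?_, ?_, ?_⟩
    · rw [neg_div, ← e4]
      field_simp
    · have : -SK * q = Δ * lam * (r₃ / b ^ 3) := by linarith
      rw [this]
      field_simp
    · rw [← e2]
      field_simp
      ring
    · rw [← e1]
      field_simp
      ring
  · rintro ⟨hSK, hEK, e1, e2, e3, e4⟩
    rw [abs_of_neg hSK] at e1 e2
    refine ⟨?_, ?_, ?_, ?_⟩
    · rw [e4]
      field_simp
      ring
    · rw [e3]
      field_simp
      ring
    · rw [e2]
      field_simp
    · rw [e1]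
      field_simp

/-- After substitution `lam / b ^ 2` is linear in `b`, and a factor that is positive when `V > 0`
splits off. The sign of `σ ^ 2` is then that of the criterion in (b). -/
theorem variance_gap_eq {r₂ r₃ r₄ Δ lam b V q w SK EK : ℝ} (h₃ : 0 < r₃) (h₄ : 0 < r₄)
    (hΔ : 0 < Δ) (hw : 0 < w) (hqw : q = V * w) (hSK : SK < 0) (hEK : 0 < EK)
    (hb : b = |SK| / (EK * w) * (r₄ / r₃)) (hlam : lam = |SK| * q * b ^ 3 / (Δ * r₃)) :
    V / Δ - r₂ * (lam / b ^ 2) = V / (Δ * EK * r₃ ^ 2) * (r₃ ^ 2 * EK - r₂ * r₄ * SK ^ 2) := by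
  have hb0 : b ≠ 0 := by
    have := abs_pos.2 hSK.ne
    rw [hb]
    positivity
  have h1 : lam / b ^ 2 = |SK| * q / (Δ * r₃) * b := by
    rw [hlam]
    field_simp
  rw [h1, hb, hqw, ← sq_abs SK]
  field_simp

end ClockRegulation

/-! ### Explicit solution, existence and uniqueness -/

open ClockRegulation in
theorem proposition3
    {Ω : Type*} [MeasurableSpace Ω] (P : Measure Ω) [IsProbabilityMeasure P]
    (ty : RegType) (n : ℝ) (hn : 0 ≤ n) (Δ : ℝ≥0) (hΔ : 0 < Δ)
    (M V SK EK : ℝ) (hV : 0 < V) :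
    (∀ (p : Params) (L : ℝ≥0 → Ω → ℝ), p.Admissible → IsJumpDiffusion P ty n 0 1 p L →
      (MatchesSample P (L Δ) M V SK EK ↔
        SK < 0 ∧ 0 < EK ∧
        p.b = |SK| / (EK * V ^ (1 / 2 : ℝ)) * (rho ty 4 n / rho ty 3 n) ∧
        p.lam = |SK| * V ^ (3 / 2 : ℝ) * p.b ^ 3 / (Δ * rho ty 3 n) ∧
        p.sigma ^ 2 = V / Δ - rho ty 2 n * (p.lam / p.b ^ 2) ∧
        p.mu = M / Δ + rho ty 1 n * (p.lam / p.b))) ∧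
    (∀ L : Params → ℝ≥0 → Ω → ℝ,
      (∀ p : Params, p.Admissible → IsJumpDiffusion P ty n 0 1 p (L p)) →
      ((∃! p : Params, p.Admissible ∧ MatchesSample P (L p Δ) M V SK EK) ↔
        SK < 0 ∧ 0 < EK ∧ rho ty 2 n * rho ty 4 n * SK ^ 2 < rho ty 3 n ^ 2 * EK)) := by
  have hΔ' : (0 : ℝ) < Δ := by exact_mod_cast hΔ
  have hw : 0 < V ^ (1 / 2 : ℝ) := by positivity
  have hq : 0 < V ^ (3 / 2 : ℝ) := by positivity
  have hqw : V ^ (3 / 2 : ℝ) = V * V ^ (1 / 2 : ℝ) := by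
    rw [← Real.rpow_one_add' hV.le (by norm_num)]
    norm_num
  have h₃ := rho_pos ty 3 hn
  have h₄ := rho_pos ty 4 hn
  have parta : ∀ (p : Params) (L : ℝ≥0 → Ω → ℝ), p.Admissible → IsJumpDiffusion P ty n 0 1 p L →
      (MatchesSample P (L Δ) M V SK EK ↔
        SK < 0 ∧ 0 < EK ∧
        p.b = |SK| / (EK * V ^ (1 / 2 : ℝ)) * (rho ty 4 n / rho ty 3 n) ∧
        p.lam = |SK| * V ^ (3 / 2 : ℝ) * p.b ^ 3 / (Δ * rho ty 3 n) ∧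
        p.sigma ^ 2 = V / Δ - rho ty 2 n * (p.lam / p.b ^ 2) ∧
        p.mu = M / Δ + rho ty 1 n * (p.lam / p.b)) := by
    intro p L hp hL
    obtain ⟨hint, hK⟩ := hL.cumulants hp hΔ
    have k1 : cumulant P (L Δ) 1 = p.mu * Δ - Δ * p.lam * (rho ty 1 n / p.b) := by
      rw [hK 1 le_rfl]; norm_num; ring
    have k2 : cumulant P (L Δ) 2 = Δ * p.lam * (rho ty 2 n / p.b ^ 2) + p.sigma ^ 2 * Δ := by
      rw [hK 2 (by norm_num)]; norm_num
    have k3 : cumulant P (L Δ) 3 = -(Δ * p.lam * (rho ty 3 n / p.b ^ 3)) := by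
      rw [hK 3 (by norm_num)]; norm_num
    have k4 : cumulant P (L Δ) 4 = Δ * p.lam * (rho ty 4 n / p.b ^ 4) := by
      rw [hK 4 (by norm_num)]; norm_num
    rw [← moment_conditions_iff h₃ h₄ hΔ' hp.1 hp.2.1 hq hw, ← k1, ← k2, ← k3, ← k4]
    exact ⟨fun h => ⟨h.first, h.second, h.third, h.ratio⟩,
      fun ⟨h1, h2, h3, h4⟩ => ⟨hint, h1, h2, h3, h4⟩⟩
  refine ⟨parta, fun L hL => ⟨?_, ?_⟩⟩
  · rintro ⟨p, ⟨hp, hm⟩, -⟩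
    obtain ⟨hSK, hEK, e1, e2, e3, -⟩ := (parta p _ hp (hL p hp)).1 hm
    refine ⟨hSK, hEK, ?_⟩
    have hσ : 0 < p.sigma ^ 2 := pow_pos hp.2.2 2
    rw [e3, variance_gap_eq h₃ h₄ hΔ' hw hqw hSK hEK e1 e2] at hσ
    exact sub_pos.1 (pos_of_mul_pos_right hσ (by positivity))
  · rintro ⟨hSK, hEK, hlt⟩
    have hSK' := abs_pos.2 hSK.ne
    set b := |SK| / (EK * V ^ (1 / 2 : ℝ)) * (rho ty 4 n / rho ty 3 n) with hb
    set lam := |SK| * V ^ (3 / 2 : ℝ) * b ^ 3 / (Δ * rho ty 3 n) with hlam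
    have hb0 : 0 < b := by positivity
    have hσ : 0 < V / Δ - rho ty 2 n * (lam / b ^ 2) := by
      rw [variance_gap_eq h₃ h₄ hΔ' hw hqw hSK hEK hb hlam]
      exact mul_pos (by positivity) (sub_pos.2 hlt)
    -- The candidate is the explicit solution of (a), with the positive root taken for the
    -- dispersion.
    let p : Params := ⟨lam, b, M / Δ + rho ty 1 n * (lam / b),
      √(V / Δ - rho ty 2 n * (lam / b ^ 2))⟩
    have hp : p.Admissible := ⟨by positivity, hb0, Real.sqrt_pos.2 hσ⟩
    refine ⟨p, ⟨hp, (parta p _ hp (hL p hp)).2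
      ⟨hSK, hEK, rfl, rfl, Real.sq_sqrt hσ.le, rfl⟩⟩, ?_⟩
    rintro p' ⟨hp', hm⟩
    obtain ⟨-, -, e1, e2, e3, e4⟩ := (parta p' _ hp' (hL p' hp')).1 hm
    have e1' : p'.b = b := e1
    have e2' : p'.lam = lam := by rw [e2, e1']
    rw [e1', e2'] at e3 e4
    ext
    · exact e2'
    · exact e1'
    · exact e4
    -- Part (a) determines only the square of the dispersion; admissibility selects the root.
    · rw [← Real.sqrt_sq hp'.2.2.le, e3]
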